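/- Let $\mathcal F$ be a finite family of distinct $3$-element subsets of a vertex set $V$ that is linear, i.e. $|A\cap B|\le 1$ for all distinct $A,B\in\mathcal F$. Let $\nu$ be the matching number of $\mathcal F$ (the maximum number of pairwise disjoint members of $\mathcal F$) and let $\Delta$ be its maximum degree (the maximum, over $x\in V$, of the number of members of $\mathcal F$ containing $x$). If $\nu\neq 1$ and $$\Delta\ \ge\ \frac{23}{6}\,\nu\left(1+\frac{1}{\nu-1}\right),$$ then $|\mathcal F|\le\Delta\nu$. Moreover, the bound is attained. Call a family of sets, each of which contains a set $X$, a sunflower with core $X$ if any two distinct members intersect exactly in $X$; its members are its petals. For all integers $\nu\ge 1$ and $\Delta\ge 1$ there is a family $\mathcal F$ that is a union of $\nu$ pairwise vertex-disjoint sunflowers of $3$-element sets, each with $\Delta$ petals and a one-vertex core; and every such family $\mathcal F$ is $3$-uniform and linear, has matching number $\nu$ and maximum degree $\Delta$, and satisfies $|\mathcal F|=\Delta\nu$. -/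

import Mathlib

namespace SetFamily

/-- A family is linear if any two distinct members share at most one vertex. -/
def IsLinear {V : Type*} [DecidableEq V] (F : Finset (Finset V)) : Prop :=
  ∀ A ∈ F, ∀ B ∈ F, A ≠ B → (A ∩ B).card ≤ 1

/-- A matching: a collection of pairwise disjoint sets. -/
abbrev IsMatching {V : Type*} [DecidableEq V] (M : Finset (Finset V)) : Prop :=
  ∀ A ∈ M, ∀ B ∈ M, A ≠ B → Disjoint A B

/-- The size of a maximum matching contained in `F`. -/
def matchingNumber {V : Type*} [DecidableEq V] (F : Finset (Finset V)) : ℕ :=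
  (F.powerset.filter fun M => IsMatching M).sup Finset.card

/-- The set of vertices covered by the members of `F`. -/
def vertices {V : Type*} [DecidableEq V] (F : Finset (Finset V)) : Finset V :=
  F.biUnion id

/-- The number of members of `F` containing `x`. -/
def degree {V : Type*} [DecidableEq V] (F : Finset (Finset V)) (x : V) : ℕ :=
  (F.filter fun A => x ∈ A).card

/-- The maximum degree. Vertices outside all members of `F` have degree `0`, so the maximum may be
taken over the covered vertices (it is `0` if there are none). -/
def maxDegree {V : Type*} [DecidableEq V] (F : Finset (Finset V)) : ℕ :=
  (vertices F).sup (degree F)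

/-- `G` is a sunflower with core `X`, its petals being the members of `G`. (The inclusion `X ⊆ A`
is automatic as soon as there are two petals.) -/
def IsSunflower {V : Type*} [DecidableEq V] (G : Finset (Finset V)) (X : Finset V) : Prop :=
  (∀ A ∈ G, X ⊆ A) ∧ ∀ A ∈ G, ∀ B ∈ G, A ≠ B → A ∩ B = X

/-- `F` is the union of `n` pairwise vertex-disjoint `3`-uniform sunflowers, each with `d` petals
and a one-vertex core. -/
def IsDisjointSunflowers {V : Type*} [DecidableEq V] (F : Finset (Finset V)) (n d : ℕ) : Prop :=
  ∃ G : Fin n → Finset (Finset V),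
    F = Finset.univ.biUnion G ∧
    (∀ i, (G i : Set (Finset V)).Sized 3 ∧ (G i).card = d ∧ ∃ c : V, IsSunflower (G i) {c}) ∧
    ∀ i j, i ≠ j → Disjoint (vertices (G i)) (vertices (G j))

end SetFamily

namespace SetFamily

variable {V : Type*} [DecidableEq V]

/-! The hypothesis says Δ(ν - 1) ≥ (23/6)ν². If some vertex has degree above 3ν, deleting its edges
lowers the matching number and costs at most Δ edges. Iterating (`exists_subfamily_degree_le`)
leaves a subfamily G with matching number n and all degrees at most 3n, and it suffices that |G| ≤
Δn. If n = ν, nothing was deleted and Δ ≤ 3ν is too small; if n = 0, G is empty. Otherwise 1 ≤ n ≤ ν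
- 1, and |G| ≤ (23/6)(n + 1)² is enough because (n + 1)²/n ≤ ν²/(ν - 1).

This last bound on |G| is `IsMaxMatching.card_le`. Fix a maximum matching M. The only tool besides
linearity is exchange (`length_le_card`): k members of M cannot be traded for k + 1 disjoint edges
that meet no other member. A member of M is a star if some vertex of it, its centre, has at least
five pendant edges; let a and b count the stars and the other members. At most 3na edges pass
through centres. Every other edge meets a non-star: it is a non-star itself, or a pendant edge at
one (at most 6 for each), or a heavy edge.

Heavy edges are counted by discharging. Pairs of vertices from different members carry weights; by
linearity each pair lies in at most one edge, and each heavy edge collects at least 12. Exchange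
bounds the weight available: at most 56 between a star and a non-star, at most 46b² - 38b among the
non-stars. The latter rests on `crossCount_triple_le`, proved by treating the third vertex of a
cross edge as the colour of the pair in M. Altogether 12|G| ≤ 36a(a + b) + 84b + (46b² - 38b) + 56ab
≤ 46(a + b + 1)². -/

/-- `M` is a maximum matching of the linear `3`-uniform family `F`. -/
structure IsMaxMatching (F M : Finset (Finset V)) : Prop where
  sized : (F : Set (Finset V)).Sized 3
  linear : IsLinear F
  subset : M ⊆ F
  matching : IsMatching M
  le_card : ∀ N ⊆ F, IsMatching N → N.card ≤ M.card

/-! ### Linearity and the exchange principle -/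

lemma mem_vertices {F : Finset (Finset V)} {v : V} : v ∈ vertices F ↔ ∃ e ∈ F, v ∈ e := by
  simp [vertices]

lemma IsLinear.eq_of_mem {F : Finset (Finset V)} (hF : IsLinear F) {A B : Finset V} (hA : A ∈ F)
    (hB : B ∈ F) {x y : V} (hxy : x ≠ y) (hxA : x ∈ A) (hyA : y ∈ A) (hxB : x ∈ B) (hyB : y ∈ B) :
    A = B := by
  by_contra h
  have h1 := hF A hA B hB h
  have h2 : ({x, y} : Finset V) ⊆ A ∩ B := by
    intro z hz
    simp only [Finset.mem_insert, Finset.mem_singleton] at hz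
    rcases hz with rfl | rfl <;> simp [*]
  have h3 := Finset.card_le_card h2
  rw [Finset.card_pair hxy] at h3
  omega

/-- More than `X.card` edges through a common vertex outside `X` cannot all meet `X`. -/
lemma IsLinear.exists_disjoint {F S : Finset (Finset V)} (hF : IsLinear F) (hS : S ⊆ F) {v : V}
    (hv : ∀ E ∈ S, v ∈ E) {X : Finset V} (hvX : v ∉ X) (hX : X.card < S.card) :
    ∃ E ∈ S, Disjoint E X := by
  by_contra! hcon
  have hex : ∀ E ∈ S, ∃ x ∈ X, x ∈ E := by
    intro E hE
    obtain ⟨x, hx1, hx2⟩ := Finset.not_disjoint_iff.1 (hcon E hE)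
    exact ⟨x, hx2, hx1⟩
  have : Nonempty V := ⟨v⟩
  -- Pigeonhole: two edges through `v` that share a further vertex of `X` would coincide.
  choose! g hg1 hg2 using hex
  obtain ⟨A, hA, B, hB, hAB, hgAB⟩ := Finset.exists_ne_map_eq_of_card_lt_of_maps_to hX hg1
  refine hAB (hF.eq_of_mem (hS hA) (hS hB) (x := v) (y := g A) ?_ (hv A hA)
    (hg2 A hA) (hv B hB) (hgAB ▸ hg2 B hB))
  rintro hvg
  exact hvX (hvg ▸ hg1 A hA)

namespace IsMaxMatching

variable {F M : Finset (Finset V)}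

lemma eq_of_mem (h : IsMaxMatching F M) {e f : Finset V} (he : e ∈ M) (hf : f ∈ M) {v : V}
    (hve : v ∈ e) (hvf : v ∈ f) : e = f := by
  by_contra hne
  exact Finset.disjoint_left.1 (h.matching e he f hf hne) hve hvf

lemma card_eq (h : IsMaxMatching F M) {e : Finset V} (he : e ∈ F) : e.card = 3 :=
  h.sized (Finset.mem_coe.2 he)

/-- If the members of `Q` are disjoint and meet the matching only inside the members of `R`, then
they cannot outnumber `R`. -/
lemma length_le_card (h : IsMaxMatching F M) {R : Finset (Finset V)} (hR : R ⊆ M)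
    {Q : List (Finset V)} (hQF : ∀ E ∈ Q, E ∈ F) (hQ : Q.Pairwise Disjoint)
    (hQR : ∀ E ∈ Q, ∀ v ∈ E, v ∈ vertices M → v ∈ vertices R) : Q.length ≤ R.card := by
  have hdis : ∀ E ∈ Q, ∀ e ∈ M \ R, Disjoint E e := by
    intro E hE e he
    rw [Finset.mem_sdiff] at he
    rw [Finset.disjoint_left]
    intro v hv hve
    obtain ⟨r, hr, hvr⟩ := mem_vertices.1 (hQR E hE v hv (mem_vertices.2 ⟨e, he.1, hve⟩))
    exact he.2 (h.eq_of_mem he.1 (hR hr) hve hvr ▸ hr)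
  have hne : ∀ E ∈ Q, E.Nonempty := fun E hE => by
    rw [← Finset.card_pos, h.card_eq (hQF E hE)]; norm_num
  have hnodup : Q.Nodup := by
    refine (List.pairwise_iff_forall_sublist.2 ?_)
    intro a b hab
    have hd : Disjoint a b := (List.pairwise_iff_forall_sublist.1 hQ) hab
    rintro rfl
    have ha : a ∈ Q := hab.subset (by simp)
    exact (hne a ha).ne_empty (by simpa using hd)
  have hpair : ∀ A ∈ Q, ∀ B ∈ Q, A ≠ B → Disjoint A B := by
    intro A hA B hB hAB
    exact hQ.forall hA hB hAB
  have hdisj : Disjoint (M \ R) Q.toFinset := by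
    rw [Finset.disjoint_left]
    intro E hE hEQ
    have hEQ' := List.mem_toFinset.1 hEQ
    exact (hne E hEQ').ne_empty (by simpa using hdis E hEQ' E hE)
  -- Exchange: trading `R` for `Q` in `M` gives another matching of `F`.
  have hle := h.le_card ((M \ R) ∪ Q.toFinset) (by
      intro E hE
      rcases Finset.mem_union.1 hE with hE | hE
      · exact h.subset (Finset.mem_sdiff.1 hE).1
      · exact hQF E (List.mem_toFinset.1 hE)) (by
      intro A hA B hB hAB
      rcases Finset.mem_union.1 hA with hA | hA <;> rcases Finset.mem_union.1 hB with hB | hB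
      · exact h.matching A (Finset.mem_sdiff.1 hA).1 B (Finset.mem_sdiff.1 hB).1 hAB
      · exact (hdis B (List.mem_toFinset.1 hB) A hA).symm
      · exact hdis A (List.mem_toFinset.1 hA) B hB
      · exact hpair A (List.mem_toFinset.1 hA) B (List.mem_toFinset.1 hB) hAB)
  rw [Finset.card_union_of_disjoint hdisj, List.toFinset_card_of_nodup hnodup,
    Finset.card_sdiff_of_subset hR] at hle
  have := Finset.card_le_card hR
  omega

end IsMaxMatching

/-! ### Cross edges and pendant edges -/

/-- The edge `{u, v, x}` meets the vertex set of `M` exactly in the pair `u, v`. -/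
def IsCrossEdge (F M : Finset (Finset V)) (u v x : V) : Prop :=
  u ∈ vertices M ∧ v ∈ vertices M ∧ x ∉ vertices M ∧ ({u, v, x} : Finset V) ∈ F

/-- The edges that meet the vertex set of `M` exactly in `v`. -/
def pendants (F M : Finset (Finset V)) (v : V) : Finset (Finset V) :=
  F.filter fun E => E ∩ vertices M = {v}

lemma IsCrossEdge.symm {F M : Finset (Finset V)} {u v x : V} (h : IsCrossEdge F M u v x) :
    IsCrossEdge F M v u x :=
  ⟨h.2.1, h.1, h.2.2.1, by rw [Finset.insert_comm]; exact h.2.2.2⟩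

lemma IsCrossEdge.disjoint {F M : Finset (Finset V)} {u v x u' v' x' : V}
    (h : IsCrossEdge F M u v x) (h' : IsCrossEdge F M u' v' x') (huu : u ≠ u') (huv : u ≠ v')
    (hvu : v ≠ u') (hvv : v ≠ v') (hx : x ≠ x') :
    Disjoint ({u, v, x} : Finset V) {u', v', x'} := by
  obtain ⟨h1, h2, h3, -⟩ := h
  obtain ⟨h1', h2', h3', -⟩ := h'
  rw [Finset.disjoint_left]
  intro z hz hz'
  simp only [Finset.mem_insert, Finset.mem_singleton] at hz hz'
  grind

lemma IsCrossEdge.mem_or {F M : Finset (Finset V)} {u v x z : V}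
    (h : IsCrossEdge F M u v x) (hz : z ∈ ({u, v, x} : Finset V)) (hzM : z ∈ vertices M) :
    z = u ∨ z = v := by
  simp only [Finset.mem_insert, Finset.mem_singleton] at hz
  rcases hz with rfl | rfl | rfl
  · simp
  · simp
  · exact absurd hzM h.2.2.1

namespace IsMaxMatching

variable {F M : Finset (Finset V)}

lemma cross_ne (h : IsMaxMatching F M) {u v x : V} (hc : IsCrossEdge F M u v x) : u ≠ v := by
  rintro rfl
  have h1 := h.card_eq hc.2.2.2
  have h2 : ({u, u, x} : Finset V).card ≤ 2 := by
    rw [Finset.insert_idem]; exact Finset.card_le_two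
  omega

lemma cross_right_unique (h : IsMaxMatching F M) {u v v' x : V} (hc : IsCrossEdge F M u v x)
    (hc' : IsCrossEdge F M u v' x) : v = v' := by
  have hux : u ≠ x := by rintro rfl; exact hc.2.2.1 hc.1
  have := h.linear.eq_of_mem hc.2.2.2 hc'.2.2.2 hux (by simp) (by simp) (by simp) (by simp)
  have hv : v ∈ ({u, v', x} : Finset V) := by rw [← this]; simp
  rcases hc'.mem_or hv hc.2.1 with hv | hv
  · exact absurd hv.symm (h.cross_ne hc)
  · exact hv

/-- View `x` as the colour of the pair `u, v`. Linearity makes this a proper edge colouring: cross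
edges at a common vertex of `M` have different colours. -/
lemma color_ne_of_left (h : IsMaxMatching F M) {u v v' x y : V} (hc : IsCrossEdge F M u v x)
    (hc' : IsCrossEdge F M u v' y) (hv : v ≠ v') : x ≠ y := by
  rintro rfl
  exact hv (h.cross_right_unique hc hc')

lemma color_ne_of_right (h : IsMaxMatching F M) {u u' v x y : V} (hc : IsCrossEdge F M u v x)
    (hc' : IsCrossEdge F M u' v y) (hu : u ≠ u') : x ≠ y :=
  h.color_ne_of_left hc.symm hc'.symm hu

lemma exists_pendant_disjoint (h : IsMaxMatching F M) {v : V} {X : Finset V} (hv : v ∉ X)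
    (hX : X.card < (pendants F M v).card) : ∃ E ∈ pendants F M v, Disjoint E X := by
  refine h.linear.exists_disjoint (Finset.filter_subset _ _) (fun E hE => ?_) hv hX
  exact (Finset.mem_inter.1 ((Finset.mem_filter.1 hE).2 ▸ Finset.mem_singleton_self v)).1

/-- Disjoint pendant edges at the centres of up to three members of `M`, avoiding a small set. -/
lemma exists_pendants (h : IsMaxMatching F M) (c : Finset V → V) (R : Finset (Finset V)) :
    R ⊆ M → (∀ e ∈ R, c e ∈ e ∧ 5 ≤ (pendants F M (c e)).card) →
    ∀ X : Finset V, Disjoint X (vertices M) → X.card + 2 * R.card ≤ 6 →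
    ∃ Q : List (Finset V), Q.length = R.card ∧ Q.Pairwise Disjoint ∧ ∀ E ∈ Q, E ∈ F ∧
      Disjoint E X ∧ ∀ z ∈ E, z ∈ vertices M → ∃ e ∈ R, z = c e := by
  induction R using Finset.induction_on with
  | empty => exact fun _ _ X _ _ => ⟨[], by simp⟩
  | insert e R he ih =>
    intro hRM hc X hXM hX
    rw [Finset.card_insert_of_notMem he] at hX
    obtain ⟨hce, hce5⟩ := hc e (by simp)
    have heM : e ∈ M := hRM (by simp)
    have hcM : c e ∈ vertices M := mem_vertices.2 ⟨e, heM, hce⟩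
    obtain ⟨E, hE, hEX⟩ := h.exists_pendant_disjoint (X := X)
      (fun hx => Finset.disjoint_left.1 hXM hx hcM) (by omega)
    rw [pendants, Finset.mem_filter] at hE
    have hEM : ∀ z ∈ E, z ∈ vertices M → z = c e := fun z hz hzM =>
      Finset.mem_singleton.1 (hE.2 ▸ Finset.mem_inter.2 ⟨hz, hzM⟩)
    have hcE : c e ∈ E := (Finset.mem_inter.1 (hE.2 ▸ Finset.mem_singleton_self (c e))).1
    have hEc : (E.erase (c e)).card = 2 := by
      rw [Finset.card_erase_of_mem hcE, h.card_eq hE.1]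
    -- The two outer vertices of `E` become forbidden for the later edges. This is the 2 per member
    -- in the budget of 6, which keeps the forbidden set at size at most 4 whenever one of five
    -- pendant edges must be chosen.
    obtain ⟨Q, hQ1, hQ2, hQ3⟩ := ih (fun r hr => hRM (by simp [hr]))
      (fun r hr => hc r (by simp [hr])) (X ∪ E.erase (c e)) (by
        rw [Finset.disjoint_union_left]
        refine ⟨hXM, Finset.disjoint_left.2 fun z hz hzM => ?_⟩
        rw [Finset.mem_erase] at hz
        exact hz.1 (hEM z hz.2 hzM)) (by
        have := Finset.card_union_le X (E.erase (c e))
        omega)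
    refine ⟨E :: Q, by simp [hQ1, he], List.pairwise_cons.2 ⟨?_, hQ2⟩, ?_⟩
    · intro E' hE'
      obtain ⟨-, hd, hz⟩ := hQ3 E' hE'
      rw [Finset.disjoint_left]
      intro z hzE hzE'
      by_cases hzc : z = c e
      · obtain ⟨r, hr, hzr⟩ := hz z hzE' (hzc ▸ hcM)
        have : e = r := h.eq_of_mem heM (hRM (by simp [hr])) hce
          (by rw [← hzc, hzr]; exact (hc r (by simp [hr])).1)
        exact he (this ▸ hr)
      · exact Finset.disjoint_left.1 hd hzE' (by simp [hzc, hzE])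
    · intro E' hE'
      rcases List.mem_cons.1 hE' with rfl | hE'
      · exact ⟨hE.1, hEX, fun z hz hzM => ⟨e, by simp, hEM z hz hzM⟩⟩
      · obtain ⟨h1, h2, h3⟩ := hQ3 E' hE'
        refine ⟨h1, (Finset.disjoint_union_right.1 h2).1, fun z hz hzM => ?_⟩
        obtain ⟨r, hr, hzr⟩ := h3 z hz hzM
        exact ⟨r, by simp [hr], hzr⟩

end IsMaxMatching

/-! ### Counting cross edges between members of the matching -/

open scoped Classical in
/-- The number of vertices of `G` that are joined to `u` by a cross edge. -/
noncomputable def crossDegree (F M : Finset (Finset V)) (u : V) (G : Finset V) : ℕ :=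
  (G.filter fun g => ∃ x, IsCrossEdge F M u g x).card

/-- The number of pairs in `e × f` that are joined by a cross edge. -/
noncomputable def crossCount (F M : Finset (Finset V)) (e f : Finset V) : ℕ :=
  ∑ u ∈ e, crossDegree F M u f

lemma crossCount_comm (F M : Finset (Finset V)) (e f : Finset V) :
    crossCount F M e f = crossCount F M f e := by
  classical
  simp only [crossCount, crossDegree, Finset.card_filter]
  rw [Finset.sum_comm]
  refine Finset.sum_congr rfl fun u _ => Finset.sum_congr rfl fun v _ => ?_
  have : (∃ x, IsCrossEdge F M v u x) ↔ ∃ x, IsCrossEdge F M u v x :=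
    ⟨fun ⟨x, hx⟩ => ⟨x, hx.symm⟩, fun ⟨x, hx⟩ => ⟨x, hx.symm⟩⟩
  simp only [this]

lemma crossDegree_le (F M : Finset (Finset V)) (u : V) (G : Finset V) :
    crossDegree F M u G ≤ G.card := by
  classical exact Finset.card_filter_le _ _

lemma forall_cross_of_card_le {F M : Finset (Finset V)} {u : V} {G : Finset V}
    (h : G.card ≤ crossDegree F M u G) : ∀ g ∈ G, ∃ x, IsCrossEdge F M u g x := by
  classical
  exact Finset.filter_eq_self.1 (Finset.eq_of_subset_of_card_le (Finset.filter_subset _ _) h)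

lemma card_eq_three_of_mem {G : Finset V} (hG : G.card = 3) {k : V} (hk : k ∈ G) :
    ∃ l m, k ≠ l ∧ k ≠ m ∧ l ≠ m ∧ G = {k, l, m} := by
  have h2 : (G.erase k).card = 2 := by rw [Finset.card_erase_of_mem hk, hG]
  obtain ⟨l, m, hlm, hG'⟩ := Finset.card_eq_two.1 h2
  have hl : l ∈ G.erase k := by rw [hG']; simp
  have hm : m ∈ G.erase k := by rw [hG']; simp
  refine ⟨l, m, (Finset.ne_of_mem_erase hl).symm, (Finset.ne_of_mem_erase hm).symm, hlm, ?_⟩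
  rw [← hG', Finset.insert_erase hk]

namespace IsMaxMatching

variable {F M : Finset (Finset V)}

lemma ne_of_mem (h : IsMaxMatching F M) {e f : Finset V} (he : e ∈ M) (hf : f ∈ M) (hef : e ≠ f)
    {u v : V} (hu : u ∈ e) (hv : v ∈ f) : u ≠ v := by
  rintro rfl
  exact hef (h.eq_of_mem he hf hu hv)

/-- Three cross edges forming a perfect matching between two members of a maximum matching are
not disjoint outside the matching. -/
lemma color_eq_of_three (h : IsMaxMatching F M) {e f : Finset V} (he : e ∈ M) (hf : f ∈ M)
    (hef : e ≠ f) {u u' u'' v v' v'' x x' x'' : V} (hu : u ∈ e) (hu' : u' ∈ e) (hu'' : u'' ∈ e)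
    (hv : v ∈ f) (hv' : v' ∈ f) (hv'' : v'' ∈ f) (huu' : u ≠ u') (huu'' : u ≠ u'')
    (hu'u'' : u' ≠ u'') (hvv' : v ≠ v') (hvv'' : v ≠ v'') (hv'v'' : v' ≠ v'')
    (h1 : IsCrossEdge F M u v x) (h2 : IsCrossEdge F M u' v' x')
    (h3 : IsCrossEdge F M u'' v'' x'') : x = x' ∨ x = x'' ∨ x' = x'' := by
  by_contra! hcon
  obtain ⟨hx1, hx2, hx3⟩ := hcon
  have hne : ∀ a ∈ e, ∀ b ∈ f, a ≠ b := fun a ha b hb => h.ne_of_mem he hf hef ha hb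
  have hlen := h.length_le_card (R := {e, f}) (Q := [{u, v, x}, {u', v', x'}, {u'', v'', x''}])
    (by intro z hz; simp only [Finset.mem_insert, Finset.mem_singleton] at hz
        rcases hz with rfl | rfl <;> assumption)
    (by
      intro E hE
      simp only [List.mem_cons, List.not_mem_nil, or_false] at hE
      rcases hE with rfl | rfl | rfl
      exacts [h1.2.2.2, h2.2.2.2, h3.2.2.2])
    (by
      simp only [List.pairwise_cons, List.mem_cons, List.not_mem_nil, or_false,
        forall_eq_or_imp, forall_eq, IsEmpty.forall_iff, implies_true, List.Pairwise.nil, and_true]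
      refine ⟨⟨?_, ?_⟩, ?_⟩
      · exact h1.disjoint h2 huu' (hne _ hu _ hv') (hne _ hu' _ hv).symm hvv' hx1
      · exact h1.disjoint h3 huu'' (hne _ hu _ hv'') (hne _ hu'' _ hv).symm hvv'' hx2
      · exact h2.disjoint h3 hu'u'' (hne _ hu' _ hv'') (hne _ hu'' _ hv').symm hv'v'' hx3)
    (by
      intro E hE z hz hzM
      simp only [List.mem_cons, List.not_mem_nil, or_false] at hE
      rw [mem_vertices]
      rcases hE with rfl | rfl | rfl
      · rcases h1.mem_or hz hzM with rfl | rfl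
        exacts [⟨e, by simp, hu⟩, ⟨f, by simp, hv⟩]
      · rcases h2.mem_or hz hzM with rfl | rfl
        exacts [⟨e, by simp, hu'⟩, ⟨f, by simp, hv'⟩]
      · rcases h3.mem_or hz hzM with rfl | rfl
        exacts [⟨e, by simp, hu''⟩, ⟨f, by simp, hv''⟩])
  rw [Finset.card_pair hef] at hlen
  simp at hlen

/-- If the four colours were distinct, four disjoint cross edges would replace the three members
`e`, `f`, `g`. -/
lemma color_eq_of_four (h : IsMaxMatching F M) {e f g : Finset V} (he : e ∈ M) (hf : f ∈ M)
    (hg : g ∈ M) (hef : e ≠ f) (heg : e ≠ g) (hfg : f ≠ g) {u u' u'' v v' v'' k l x y z w : V}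
    (hu : u ∈ e) (hu' : u' ∈ e) (hu'' : u'' ∈ e)
    (hv : v ∈ f) (hv' : v' ∈ f) (hv'' : v'' ∈ f) (hk : k ∈ g) (hl : l ∈ g)
    (huu' : u ≠ u') (huu'' : u ≠ u'')
    (hu'u'' : u' ≠ u'') (hvv' : v ≠ v') (hvv'' : v ≠ v'') (hv'v'' : v' ≠ v'') (hkl : k ≠ l)
    (h1 : IsCrossEdge F M u k x) (h2 : IsCrossEdge F M v l y)
    (h3 : IsCrossEdge F M u' v' z) (h4 : IsCrossEdge F M u'' v'' w) :
    x = y ∨ x = z ∨ x = w ∨ y = z ∨ y = w ∨ z = w := by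
  by_contra! hcon
  obtain ⟨hxy, hxz, hxw, hyz, hyw, hzw⟩ := hcon
  have hne : ∀ a ∈ e, ∀ b ∈ f, a ≠ b := fun a ha b hb => h.ne_of_mem he hf hef ha hb
  have hne2 : ∀ a ∈ e, ∀ b ∈ g, a ≠ b := fun a ha b hb => h.ne_of_mem he hg heg ha hb
  have hne3 : ∀ a ∈ f, ∀ b ∈ g, a ≠ b := fun a ha b hb => h.ne_of_mem hf hg hfg ha hb
  have hlen := h.length_le_card (R := {e, f, g})
    (Q := [{u, k, x}, {v, l, y}, {u', v', z}, {u'', v'', w}])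
    (by intro z hz; simp only [Finset.mem_insert, Finset.mem_singleton] at hz
        rcases hz with rfl | rfl | rfl <;> assumption)
    (by
      intro E hE
      simp only [List.mem_cons, List.not_mem_nil, or_false] at hE
      rcases hE with rfl | rfl | rfl | rfl
      exacts [h1.2.2.2, h2.2.2.2, h3.2.2.2, h4.2.2.2])
    (by
      simp only [List.pairwise_cons, List.mem_cons, List.not_mem_nil, or_false,
        forall_eq_or_imp, forall_eq, IsEmpty.forall_iff, implies_true, List.Pairwise.nil, and_true]
      refine ⟨⟨?_, ?_, ?_⟩, ⟨?_, ?_⟩, ?_⟩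
      · exact h1.disjoint h2 (hne _ hu _ hv) (hne2 _ hu _ hl) (hne3 _ hv _ hk).symm hkl hxy
      · exact h1.disjoint h3 huu' (hne _ hu _ hv') (hne2 _ hu' _ hk).symm
          (hne3 _ hv' _ hk).symm hxz
      · exact h1.disjoint h4 huu'' (hne _ hu _ hv'') (hne2 _ hu'' _ hk).symm
          (hne3 _ hv'' _ hk).symm hxw
      · exact h2.disjoint h3 (hne _ hu' _ hv).symm hvv' (hne2 _ hu' _ hl).symm
          (hne3 _ hv' _ hl).symm hyz
      · exact h2.disjoint h4 (hne _ hu'' _ hv).symm hvv'' (hne2 _ hu'' _ hl).symm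
          (hne3 _ hv'' _ hl).symm hyw
      · exact h3.disjoint h4 hu'u'' (hne _ hu' _ hv'') (hne _ hu'' _ hv').symm hv'v'' hzw)
    (by
      intro E hE z hz hzM
      simp only [List.mem_cons, List.not_mem_nil, or_false] at hE
      rw [mem_vertices]
      rcases hE with rfl | rfl | rfl | rfl
      · rcases h1.mem_or hz hzM with rfl | rfl
        exacts [⟨e, by simp, hu⟩, ⟨g, by simp, hk⟩]
      · rcases h2.mem_or hz hzM with rfl | rfl
        exacts [⟨f, by simp, hv⟩, ⟨g, by simp, hl⟩]
      · rcases h3.mem_or hz hzM with rfl | rfl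
        exacts [⟨e, by simp, hu'⟩, ⟨f, by simp, hv'⟩]
      · rcases h4.mem_or hz hzM with rfl | rfl
        exacts [⟨e, by simp, hu''⟩, ⟨f, by simp, hv''⟩])
  have := Finset.card_le_three (a := e) (b := f) (c := g)
  simp only [List.length_cons, List.length_nil] at hlen
  omega

end IsMaxMatching

/-! ### Rich pairs and the bound 21 for triples -/

/-- The only way (up to relabelling) in which eight of the nine pairs between two members of a
maximum matching can lie in cross edges; `a, b, c, d` are the outer vertices of those edges. -/
structure IsRich (F M : Finset (Finset V)) (e f : Finset V)
    (e₁ e₂ e₃ f₁ f₂ f₃ a b c d : V) : Prop where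
  left_mem : e ∈ M
  right_mem : f ∈ M
  ne : e ≠ f
  left_eq : e = {e₁, e₂, e₃}
  right_eq : f = {f₁, f₂, f₃}
  he₁₂ : e₁ ≠ e₂
  he₁₃ : e₁ ≠ e₃
  he₂₃ : e₂ ≠ e₃
  hf₁₂ : f₁ ≠ f₂
  hf₁₃ : f₁ ≠ f₃
  hf₂₃ : f₂ ≠ f₃
  h₁₁ : IsCrossEdge F M e₁ f₁ a
  h₁₂ : IsCrossEdge F M e₁ f₂ c
  h₁₃ : IsCrossEdge F M e₁ f₃ b
  h₂₁ : IsCrossEdge F M e₂ f₁ d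
  h₂₂ : IsCrossEdge F M e₂ f₂ b
  h₂₃ : IsCrossEdge F M e₂ f₃ a
  h₃₁ : IsCrossEdge F M e₃ f₁ c
  h₃₂ : IsCrossEdge F M e₃ f₂ d

namespace IsRich

variable {F M : Finset (Finset V)} {e f : Finset V} {e₁ e₂ e₃ f₁ f₂ f₃ a b c d : V}

/-- The colour table has rows (a, c, b), (d, b, a), (c, d, –). Swapping the first two rows and the
first two columns preserves its shape; so does transposition, provided `e₁` and `e₂` are swapped
too. These symmetries spare repeated arguments. -/
lemma flip (r : IsRich F M e f e₁ e₂ e₃ f₁ f₂ f₃ a b c d) :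
    IsRich F M e f e₂ e₁ e₃ f₂ f₁ f₃ b a d c where
  left_mem := r.left_mem
  right_mem := r.right_mem
  ne := r.ne
  left_eq := by rw [r.left_eq, Finset.insert_comm]
  right_eq := by rw [r.right_eq, Finset.insert_comm]
  he₁₂ := r.he₁₂.symm
  he₁₃ := r.he₂₃
  he₂₃ := r.he₁₃
  hf₁₂ := r.hf₁₂.symm
  hf₁₃ := r.hf₂₃
  hf₂₃ := r.hf₁₃
  h₁₁ := r.h₂₂
  h₁₂ := r.h₂₁
  h₁₃ := r.h₂₃
  h₂₁ := r.h₁₂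
  h₂₂ := r.h₁₁
  h₂₃ := r.h₁₃
  h₃₁ := r.h₃₂
  h₃₂ := r.h₃₁

lemma transpose (r : IsRich F M e f e₁ e₂ e₃ f₁ f₂ f₃ a b c d) :
    IsRich F M f e f₁ f₂ f₃ e₂ e₁ e₃ d c a b where
  left_mem := r.right_mem
  right_mem := r.left_mem
  ne := r.ne.symm
  left_eq := r.right_eq
  right_eq := by rw [r.left_eq, Finset.insert_comm]
  he₁₂ := r.hf₁₂
  he₁₃ := r.hf₁₃
  he₂₃ := r.hf₂₃
  hf₁₂ := r.he₁₂.symm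
  hf₁₃ := r.he₂₃
  hf₂₃ := r.he₁₃
  h₁₁ := r.h₂₁.symm
  h₁₂ := r.h₁₁.symm
  h₁₃ := r.h₃₁.symm
  h₂₁ := r.h₂₂.symm
  h₂₂ := r.h₁₂.symm
  h₂₃ := r.h₃₂.symm
  h₃₁ := r.h₂₃.symm
  h₃₂ := r.h₁₃.symm

lemma mem (r : IsRich F M e f e₁ e₂ e₃ f₁ f₂ f₃ a b c d) :
    (e₁ ∈ e ∧ e₂ ∈ e ∧ e₃ ∈ e) ∧ f₁ ∈ f ∧ f₂ ∈ f ∧ f₃ ∈ f := by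
  rw [r.left_eq, r.right_eq]; simp

lemma crossCount_left (r : IsRich F M e f e₁ e₂ e₃ f₁ f₂ f₃ a b c d) (g : Finset V) :
    crossCount F M e g = crossDegree F M e₁ g + crossDegree F M e₂ g + crossDegree F M e₃ g := by
  rw [r.left_eq, crossCount, Finset.sum_insert (by simp [r.he₁₂, r.he₁₃]),
    Finset.sum_pair r.he₂₃, add_assoc]

/-- The cross edges `e₂f₃` and `e₃f₂`, coloured `a` and `d`, leave `e₁` and `f₁` free to be joined
to `g`. With the colour at `e₁k` different from `d`, exchange forces every cross edge from `f₁` to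
`g` avoiding `k` to have that same colour, so there cannot be two of them. -/
lemma crossDegree_first (h : IsMaxMatching F M) (r : IsRich F M e f e₁ e₂ e₃ f₁ f₂ f₃ a b c d)
    {g : Finset V} (hg : g ∈ M) (heg : e ≠ g) (hfg : f ≠ g)
    (h2 : 2 ≤ crossDegree F M e₁ g) : crossDegree F M f₁ g ≤ 2 := by
  classical
  obtain ⟨⟨me₁, me₂, me₃⟩, mf₁, mf₂, mf₃⟩ := r.mem
  have hg3 : g.card = 3 := h.card_eq (h.subset hg)
  -- Two cross edges at `e₁` have different colours, so one of them avoids `d`.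
  obtain ⟨k, hk, x, hx, hxd⟩ : ∃ k ∈ g, ∃ x, IsCrossEdge F M e₁ k x ∧ x ≠ d := by
    obtain ⟨k, hk, k', hk', hkk⟩ := Finset.one_lt_card.1 (show 1 < (g.filter fun k =>
      ∃ x, IsCrossEdge F M e₁ k x).card from h2)
    rw [Finset.mem_filter] at hk hk'
    obtain ⟨hk, x, hx⟩ := hk
    obtain ⟨hk', x', hx'⟩ := hk'
    by_cases hxd : x = d
    · exact ⟨k', hk', x', hx', fun hd => h.color_ne_of_left hx hx' hkk (hxd.trans hd.symm)⟩
    · exact ⟨k, hk, x, hx, hxd⟩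
  by_contra! hcon
  have hall := forall_cross_of_card_le (F := F) (M := M) (u := f₁) (G := g) (by omega)
  have hcol : ∀ l ∈ g, k ≠ l → IsCrossEdge F M f₁ l x := by
    intro l hl hkl
    obtain ⟨y, hy⟩ := hall l hl
    have e1 := h.color_eq_of_four r.left_mem r.right_mem hg r.ne heg hfg me₁ me₂ me₃ mf₁ mf₃ mf₂ hk
      hl r.he₁₂ r.he₁₃ r.he₂₃ r.hf₁₃ r.hf₁₂ r.hf₂₃.symm hkl hx hy r.h₂₃ r.h₃₂
    have e2 := h.color_ne_of_left hx r.h₁₁ (h.ne_of_mem r.right_mem hg hfg mf₁ hk).symm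
    have e3 := h.color_ne_of_left hy r.h₁₁.symm (h.ne_of_mem r.left_mem hg heg me₁ hl).symm
    have e4 := h.color_ne_of_left hy r.h₂₁.symm (h.ne_of_mem r.left_mem hg heg me₂ hl).symm
    have e5 := h.color_ne_of_right r.h₁₁ r.h₂₁ r.he₁₂
    have : x = y := by tauto
    exact this ▸ hy
  obtain ⟨l, m, hkl, hkm, hlm, rfl⟩ := card_eq_three_of_mem hg3 hk
  exact hlm (h.cross_right_unique (hcol l (by simp) hkl) (hcol m (by simp) hkm))

/-- Full degree at `e₃` provides an edge `e₃k` whose colour `x` is none of `a`, `b`, `c`, `d`. For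
each `v` in `f`, the rest of `f` is matched to `e₁, e₂` in two colours already present at `v`, so
exchange forces colour `x` on every cross edge from `v` to `g` avoiding `k`. Each of the other two
vertices of `g` then receives at most one such edge, giving at most 3 + 1 + 1 in all. -/
lemma crossDegree_third (h : IsMaxMatching F M) (r : IsRich F M e f e₁ e₂ e₃ f₁ f₂ f₃ a b c d)
    {g : Finset V} (hg : g ∈ M) (heg : e ≠ g) (hfg : f ≠ g)
    (h6 : 6 ≤ crossCount F M f g) : crossDegree F M e₃ g ≤ 2 := by
  classical
  obtain ⟨⟨me₁, me₂, me₃⟩, mf₁, mf₂, mf₃⟩ := r.mem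
  have hg3 : g.card = 3 := h.card_eq (h.subset hg)
  by_contra! hcon
  have hall := forall_cross_of_card_le (F := F) (M := M) (u := e₃) (G := g) (by omega)
  -- Three distinct colours occur at `e₃`, and only two are to be avoided.
  obtain ⟨k, hk, x, hx, hxa, hxb⟩ : ∃ k ∈ g, ∃ x, IsCrossEdge F M e₃ k x ∧ x ≠ a ∧ x ≠ b := by
    obtain ⟨k, l, m, hkl, hkm, hlm, rfl⟩ := Finset.card_eq_three.1 hg3
    obtain ⟨x, hx⟩ := hall k (by simp)
    obtain ⟨y, hy⟩ := hall l (by simp)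
    obtain ⟨z, hz⟩ := hall m (by simp)
    have e1 := h.color_ne_of_left hx hy hkl
    have e2 := h.color_ne_of_left hx hz hkm
    have e3 := h.color_ne_of_left hy hz hlm
    by_cases hxab : x ≠ a ∧ x ≠ b
    · exact ⟨k, by simp, x, hx, hxab⟩
    by_cases hyab : y ≠ a ∧ y ≠ b
    · exact ⟨l, by simp, y, hy, hyab⟩
    exact ⟨m, by simp, z, hz, by grind⟩
  have hxc := h.color_ne_of_left hx r.h₃₁ (h.ne_of_mem r.right_mem hg hfg mf₁ hk).symm
  have hxd := h.color_ne_of_left hx r.h₃₂ (h.ne_of_mem r.right_mem hg hfg mf₂ hk).symm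
  have hcol : ∀ v ∈ f, ∀ l ∈ g, k ≠ l → (∃ y, IsCrossEdge F M v l y) → IsCrossEdge F M v l x := by
    rintro v hv l hl hkl ⟨y, hy⟩
    have n1 := (h.ne_of_mem r.left_mem hg heg me₁ hl).symm
    have n2 := (h.ne_of_mem r.left_mem hg heg me₂ hl).symm
    have n3 := (h.ne_of_mem r.left_mem hg heg me₃ hl).symm
    suffices x = y from this ▸ hy
    rw [r.right_eq] at hv
    simp only [Finset.mem_insert, Finset.mem_singleton] at hv
    rcases hv with rfl | rfl | rfl
    · have e1 := h.color_eq_of_four r.left_mem r.right_mem hg r.ne heg hfg me₃ me₁ me₂ mf₁ mf₂ mf₃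
        hk hl r.he₁₃.symm r.he₂₃.symm r.he₁₂ r.hf₁₂ r.hf₁₃ r.hf₂₃ hkl hx hy r.h₁₂ r.h₂₃
      have e2 := h.color_ne_of_left hy r.h₃₁.symm n3
      have e3 := h.color_ne_of_left hy r.h₁₁.symm n1
      have e4 := h.color_ne_of_left r.h₁₁ r.h₁₂ r.hf₁₂
      have e4' := e4.symm
      tauto
    · have e1 := h.color_eq_of_four r.left_mem r.right_mem hg r.ne heg hfg me₃ me₁ me₂ mf₂ mf₃ mf₁
        hk hl r.he₁₃.symm r.he₂₃.symm r.he₁₂ r.hf₂₃ r.hf₁₂.symm r.hf₁₃.symm hkl hx hy r.h₁₃ r.h₂₁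
      have e2 := h.color_ne_of_left hy r.h₂₂.symm n2
      have e3 := h.color_ne_of_left hy r.h₃₂.symm n3
      have e4 := h.color_ne_of_left r.h₂₂ r.h₂₁ r.hf₁₂.symm
      tauto
    · have e1 := h.color_eq_of_four r.left_mem r.right_mem hg r.ne heg hfg me₃ me₁ me₂ mf₃ mf₁ mf₂
        hk hl r.he₁₃.symm r.he₂₃.symm r.he₁₂ r.hf₁₃.symm r.hf₂₃.symm r.hf₁₂ hkl hx hy r.h₁₁ r.h₂₂
      have e2 := h.color_ne_of_left hy r.h₁₃.symm n1
      have e3 := h.color_ne_of_left hy r.h₂₃.symm n2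
      have e4 := h.color_ne_of_left r.h₁₁ r.h₁₃ r.hf₁₃
      tauto
  obtain ⟨l, m, hkl, hkm, hlm, rfl⟩ := card_eq_three_of_mem hg3 hk
  have hind : ∀ p q : Prop, ¬ (p ∧ q) → (if p then 1 else 0) + (if q then 1 else 0) ≤ 1 := by
    intro p q hpq
    split_ifs <;> simp_all
  have hrow : ∀ v ∈ f, crossDegree F M v {k, l, m} ≤ 1 +
      (if ∃ x, IsCrossEdge F M v l x then 1 else 0) +
      (if ∃ x, IsCrossEdge F M v m x then 1 else 0) := by
    intro v _
    rw [crossDegree, Finset.card_filter, Finset.sum_insert (by simp [hkl, hkm]),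
      Finset.sum_pair hlm]
    split_ifs <;> omega
  have hcolumn : ∀ v ∈ f, ∀ v' ∈ f, v ≠ v' → ∀ l' ∈ ({k, l, m} : Finset V), k ≠ l' →
      (if ∃ x, IsCrossEdge F M v l' x then 1 else 0) +
      (if ∃ x, IsCrossEdge F M v' l' x then 1 else 0) ≤ 1 := by
    intro v hv v' hv' hvv l' hl' hkl'
    refine hind _ _ fun hp => hvv ?_
    exact h.cross_right_unique (hcol v hv l' hl' hkl' hp.1).symm (hcol v' hv' l' hl' hkl' hp.2).symm
  have hl : l ∈ ({k, l, m} : Finset V) := by simp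
  have hm : m ∈ ({k, l, m} : Finset V) := by simp
  rw [r.transpose.crossCount_left] at h6
  have q1 := hrow f₁ mf₁
  have q2 := hrow f₂ mf₂
  have q3 := hrow f₃ mf₃
  have c1 := hcolumn f₁ mf₁ f₂ mf₂ r.hf₁₂ l hl hkl
  have c2 := hcolumn f₁ mf₁ f₃ mf₃ r.hf₁₃ l hl hkl
  have c3 := hcolumn f₂ mf₂ f₃ mf₃ r.hf₂₃ l hl hkl
  have c4 := hcolumn f₁ mf₁ f₂ mf₂ r.hf₁₂ m hm hkm
  have c5 := hcolumn f₁ mf₁ f₃ mf₃ r.hf₁₃ m hm hkm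
  have c6 := hcolumn f₂ mf₂ f₃ mf₃ r.hf₂₃ m hm hkm
  omega

/-- A total of 14 makes both counts at least 6, so the third vertices contribute at most 2 each and
the other four at least 10. One of these four then has degree 3; the implications of
`crossDegree_first` and its symmetric forms limit the others too much. -/
lemma crossCount_add_le (h : IsMaxMatching F M) (r : IsRich F M e f e₁ e₂ e₃ f₁ f₂ f₃ a b c d)
    {g : Finset V} (hg : g ∈ M) (heg : e ≠ g) (hfg : f ≠ g)
    (he8 : crossCount F M e g ≤ 8) (hf8 : crossCount F M f g ≤ 8) :
    crossCount F M e g + crossCount F M f g ≤ 13 := by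
  by_contra! hcon
  have hg3 : g.card = 3 := h.card_eq (h.subset hg)
  have t1 := r.crossDegree_third h hg heg hfg (by omega)
  have t2 := r.transpose.crossDegree_third h hg hfg heg (by omega)
  have u1 := r.crossDegree_first h hg heg hfg
  have u2 := r.flip.crossDegree_first h hg heg hfg
  have u3 := r.transpose.crossDegree_first h hg hfg heg
  have u4 := r.transpose.flip.crossDegree_first h hg hfg heg
  rw [r.crossCount_left, r.transpose.crossCount_left] at hcon
  have b1 := crossDegree_le F M e₁ g
  have b2 := crossDegree_le F M e₂ g
  have b3 := crossDegree_le F M f₁ g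
  have b4 := crossDegree_le F M f₂ g
  omega

end IsRich

namespace IsMaxMatching

variable {F M : Finset (Finset V)}

/-- Four perfect matchings avoid the pair `e₃, f₃`, and each must repeat a colour. A proper
colouring satisfies this in just two ways, interchanged by swapping `e₁` and `e₂`. -/
lemma exists_isRich (h : IsMaxMatching F M) {e f : Finset V} (he : e ∈ M) (hf : f ∈ M)
    (hef : e ≠ f) {e₁ e₂ e₃ f₁ f₂ f₃ : V} (hee : e = {e₁, e₂, e₃}) (hff : f = {f₁, f₂, f₃})
    (he₁₂ : e₁ ≠ e₂) (he₁₃ : e₁ ≠ e₃) (he₂₃ : e₂ ≠ e₃)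
    (hf₁₂ : f₁ ≠ f₂) (hf₁₃ : f₁ ≠ f₃) (hf₂₃ : f₂ ≠ f₃)
    (hc : ∀ u ∈ e, ∀ v ∈ f, (u, v) ≠ (e₃, f₃) → ∃ x, IsCrossEdge F M u v x) :
    ∃ e₁ e₂ f₁ f₂ a b c d, IsRich F M e f e₁ e₂ e₃ f₁ f₂ f₃ a b c d := by
  have me₁ : e₁ ∈ e := by simp [hee]
  have me₂ : e₂ ∈ e := by simp [hee]
  have me₃ : e₃ ∈ e := by simp [hee]
  have mf₁ : f₁ ∈ f := by simp [hff]
  have mf₂ : f₂ ∈ f := by simp [hff]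
  have mf₃ : f₃ ∈ f := by simp [hff]
  obtain ⟨x₁₁, h₁₁⟩ := hc e₁ me₁ f₁ mf₁ (by simp [he₁₃])
  obtain ⟨x₁₂, h₁₂⟩ := hc e₁ me₁ f₂ mf₂ (by simp [he₁₃])
  obtain ⟨x₁₃, h₁₃⟩ := hc e₁ me₁ f₃ mf₃ (by simp [he₁₃])
  obtain ⟨x₂₁, h₂₁⟩ := hc e₂ me₂ f₁ mf₁ (by simp [he₂₃])
  obtain ⟨x₂₂, h₂₂⟩ := hc e₂ me₂ f₂ mf₂ (by simp [he₂₃])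
  obtain ⟨x₂₃, h₂₃⟩ := hc e₂ me₂ f₃ mf₃ (by simp [he₂₃])
  obtain ⟨x₃₁, h₃₁⟩ := hc e₃ me₃ f₁ mf₁ (by simp [hf₁₃])
  obtain ⟨x₃₂, h₃₂⟩ := hc e₃ me₃ f₂ mf₂ (by simp [hf₂₃])
  have p1 := h.color_eq_of_three he hf hef me₁ me₂ me₃ mf₁ mf₃ mf₂ he₁₂ he₁₃ he₂₃ hf₁₃ hf₁₂
    hf₂₃.symm h₁₁ h₂₃ h₃₂
  have p2 := h.color_eq_of_three he hf hef me₁ me₂ me₃ mf₃ mf₂ mf₁ he₁₂ he₁₃ he₂₃ hf₂₃.symm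
    hf₁₃.symm hf₁₂.symm h₁₃ h₂₂ h₃₁
  have p3 := h.color_eq_of_three he hf hef me₁ me₂ me₃ mf₂ mf₃ mf₁ he₁₂ he₁₃ he₂₃ hf₂₃
    hf₁₂.symm hf₁₃.symm h₁₂ h₂₃ h₃₁
  have p4 := h.color_eq_of_three he hf hef me₁ me₂ me₃ mf₃ mf₁ mf₂ he₁₂ he₁₃ he₂₃ hf₁₃.symm
    hf₂₃.symm hf₁₂ h₁₃ h₂₁ h₃₂
  have r1 := h.color_ne_of_left h₁₁ h₁₂ hf₁₂
  have r2 := h.color_ne_of_left h₁₁ h₁₃ hf₁₃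
  have r3 := h.color_ne_of_left h₁₂ h₁₃ hf₂₃
  have r4 := h.color_ne_of_left h₂₁ h₂₂ hf₁₂
  have r5 := h.color_ne_of_left h₂₁ h₂₃ hf₁₃
  have r6 := h.color_ne_of_left h₂₂ h₂₃ hf₂₃
  have r7 := h.color_ne_of_left h₃₁ h₃₂ hf₁₂
  have c1 := h.color_ne_of_right h₁₁ h₂₁ he₁₂
  have c2 := h.color_ne_of_right h₁₁ h₃₁ he₁₃
  have c3 := h.color_ne_of_right h₂₁ h₃₁ he₂₃
  have c4 := h.color_ne_of_right h₁₂ h₂₂ he₁₂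
  have c5 := h.color_ne_of_right h₁₂ h₃₂ he₁₃
  have c6 := h.color_ne_of_right h₂₂ h₃₂ he₂₃
  have c7 := h.color_ne_of_right h₁₃ h₂₃ he₁₂
  have key : (x₂₃ = x₁₁ ∧ x₃₁ = x₁₂ ∧ x₂₂ = x₁₃ ∧ x₃₂ = x₂₁) ∨
      (x₃₂ = x₁₁ ∧ x₁₃ = x₂₁ ∧ x₃₁ = x₂₂ ∧ x₂₃ = x₁₂) := by
    clear * - p1 p2 p3 p4 r1 r2 r3 r4 r5 r6 r7 c1 c2 c3 c4 c5 c6 c7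
    grind
  rcases key with ⟨rfl, rfl, rfl, rfl⟩ | ⟨rfl, rfl, rfl, rfl⟩
  · exact ⟨e₁, e₂, f₁, f₂, _, _, _, _, ⟨he, hf, hef, hee, hff, he₁₂, he₁₃, he₂₃, hf₁₂, hf₁₃, hf₂₃,
      h₁₁, h₁₂, h₁₃, h₂₁, h₂₂, h₂₃, h₃₁, h₃₂⟩⟩
  · exact ⟨e₂, e₁, f₁, f₂, _, _, _, _, ⟨he, hf, hef, by rw [hee, Finset.insert_comm], hff,
      he₁₂.symm, he₂₃, he₁₃, hf₁₂, hf₁₃, hf₂₃, h₂₁, h₂₂, h₂₃, h₁₁, h₁₂, h₁₃, h₃₁, h₃₂⟩⟩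

lemma exists_isRich_of_eight_le (h : IsMaxMatching F M) {e f : Finset V} (he : e ∈ M) (hf : f ∈ M)
    (hef : e ≠ f) (h8 : 8 ≤ crossCount F M e f) :
    ∃ e₁ e₂ e₃ f₁ f₂ f₃ a b c d, IsRich F M e f e₁ e₂ e₃ f₁ f₂ f₃ a b c d := by
  classical
  have he3 := h.card_eq (h.subset he)
  have hf3 := h.card_eq (h.subset hf)
  set P := (e ×ˢ f).filter fun p => ¬ ∃ x, IsCrossEdge F M p.1 p.2 x with hP
  have hPcard : P.card ≤ 1 := by
    have h1 : ((e ×ˢ f).filter fun p => ∃ x, IsCrossEdge F M p.1 p.2 x).card + P.card =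
        (e ×ˢ f).card := Finset.card_filter_add_card_filter_not _
    have h2 : ((e ×ˢ f).filter fun p => ∃ x, IsCrossEdge F M p.1 p.2 x).card
        = crossCount F M e f := by
      rw [Finset.card_filter, Finset.sum_product, crossCount]
      exact Finset.sum_congr rfl fun u _ => by rw [crossDegree, Finset.card_filter]
    rw [h2, Finset.card_product, he3, hf3] at h1
    omega
  obtain ⟨u₀, hu₀, v₀, hv₀, hc⟩ : ∃ u₀ ∈ e, ∃ v₀ ∈ f, ∀ u ∈ e, ∀ v ∈ f, (u, v) ≠ (u₀, v₀) →
      -- The exceptional pair is the missing one if there is one, and arbitrary otherwise.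
      ∃ x, IsCrossEdge F M u v x := by
    obtain ⟨⟨u₀, v₀⟩, hmem, hsub⟩ : ∃ p ∈ e ×ˢ f, ∀ q ∈ P, q = p := by
      rcases P.eq_empty_or_nonempty with hE | ⟨p, hp⟩
      · have hne : (e ×ˢ f).Nonempty := by
          rw [← Finset.card_pos, Finset.card_product, he3, hf3]; norm_num
        obtain ⟨p, hp⟩ := hne
        exact ⟨p, hp, by simp [hE]⟩
      · exact ⟨p, (Finset.mem_filter.1 hp).1, fun q hq => Finset.card_le_one.1 hPcard q hq p hp⟩
    rw [Finset.mem_product] at hmem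
    refine ⟨u₀, hmem.1, v₀, hmem.2, fun u hu v hv hne => ?_⟩
    by_contra hcon
    exact hne (hsub (u, v) (Finset.mem_filter.2 ⟨Finset.mem_product.2 ⟨hu, hv⟩, hcon⟩))
  obtain ⟨e₁, e₂, h1, h2, h3, hee⟩ := card_eq_three_of_mem he3 hu₀
  obtain ⟨f₁, f₂, k1, k2, k3, hff⟩ := card_eq_three_of_mem hf3 hv₀
  obtain ⟨e₁', e₂', f₁', f₂', a, b, c, d, r⟩ := h.exists_isRich he hf hef
    (e₁ := e₁) (e₂ := e₂) (e₃ := u₀) (f₁ := f₁) (f₂ := f₂) (f₃ := v₀)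
    (by rw [hee]; ext; simp; tauto) (by rw [hff]; ext; simp; tauto) h3 h1.symm h2.symm k3 k1.symm
    k2.symm hc
  exact ⟨_, _, _, _, _, _, _, _, _, _, r⟩

/-- A ninth cross edge `e₃f₃` would need colour `a` or `b` to complete the matching `e₁f₁`, `e₂f₂`,
but both colours already occur at `f₃`. -/
lemma crossCount_le_eight (h : IsMaxMatching F M) {e f : Finset V} (he : e ∈ M) (hf : f ∈ M)
    (hef : e ≠ f) : crossCount F M e f ≤ 8 := by
  by_contra! hcon
  obtain ⟨e₁, e₂, e₃, f₁, f₂, f₃, a, b, c, d, r⟩ := h.exists_isRich_of_eight_le he hf hef (by omega)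
  obtain ⟨⟨me₁, me₂, me₃⟩, mf₁, mf₂, mf₃⟩ := r.mem
  have hf3 := h.card_eq (h.subset hf)
  have b1 := crossDegree_le F M e₁ f
  have b2 := crossDegree_le F M e₂ f
  rw [r.crossCount_left] at hcon
  obtain ⟨z, hz⟩ := forall_cross_of_card_le (F := F) (M := M) (u := e₃) (G := f) (by omega) f₃ mf₃
  have p := h.color_eq_of_three he hf hef me₁ me₂ me₃ mf₁ mf₂ mf₃ r.he₁₂ r.he₁₃ r.he₂₃ r.hf₁₂
    r.hf₁₃ r.hf₂₃ r.h₁₁ r.h₂₂ hz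
  have q1 := h.color_ne_of_left r.h₁₁ r.h₁₃ r.hf₁₃
  have q2 := h.color_ne_of_right r.h₁₃ hz r.he₁₃
  have q3 := h.color_ne_of_right r.h₂₃ hz r.he₂₃
  tauto

/-- Among the `27` pairs between three members of a maximum matching, at most `21` lie in
cross edges. -/
lemma crossCount_triple_le (h : IsMaxMatching F M) {e f g : Finset V} (he : e ∈ M) (hf : f ∈ M)
    (hg : g ∈ M) (hef : e ≠ f) (heg : e ≠ g) (hfg : f ≠ g) :
    crossCount F M e f + crossCount F M f g + crossCount F M e g ≤ 21 := by
  have b1 := h.crossCount_le_eight he hf hef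
  have b2 := h.crossCount_le_eight he hg heg
  have b3 := h.crossCount_le_eight hf hg hfg
  by_cases c1 : 8 ≤ crossCount F M e f
  · obtain ⟨e₁, e₂, e₃, f₁, f₂, f₃, a, b, c, d, r⟩ := h.exists_isRich_of_eight_le he hf hef c1
    have := r.crossCount_add_le h hg heg hfg b2 b3
    omega
  by_cases c2 : 8 ≤ crossCount F M e g
  · obtain ⟨e₁, e₂, e₃, f₁, f₂, f₃, a, b, c, d, r⟩ := h.exists_isRich_of_eight_le he hg heg c2
    have := r.crossCount_add_le h hf hef hfg.symm b1 (by rwa [crossCount_comm])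
    rw [crossCount_comm F M g f] at this
    omega
  by_cases c3 : 8 ≤ crossCount F M f g
  · obtain ⟨e₁, e₂, e₃, f₁, f₂, f₃, a, b, c, d, r⟩ := h.exists_isRich_of_eight_le hf hg hfg c3
    have := r.crossCount_add_le h he hef.symm heg.symm (by rwa [crossCount_comm])
      (by rwa [crossCount_comm])
    rw [crossCount_comm F M f e, crossCount_comm F M g e] at this
    omega
  omega

end IsMaxMatching

/-! ### Stars and exchanges through their centres -/

/-- `A` consists of members `e` of `M` with at least five pendant edges at their centre `c e`. -/
def AreStars (F M A : Finset (Finset V)) (c : Finset V → V) : Prop :=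
  A ⊆ M ∧ ∀ e ∈ A, c e ∈ e ∧ 5 ≤ (pendants F M (c e)).card

/-- The pair `u, v` lies in an edge whose third vertex is a non-central vertex of a star
other than `e`. -/
def IsMixed (F A : Finset (Finset V)) (c : Finset V → V) (e : Finset V) (u v : V) : Prop :=
  ∃ e' ∈ A, e' ≠ e ∧ ∃ w ∈ e', w ≠ c e' ∧ ({u, v, w} : Finset V) ∈ F

namespace IsMaxMatching

variable {F M A : Finset (Finset V)} {c : Finset V → V}

/-- Every edge avoiding the centres of the stars meets a member of `M` that is not a star. -/
lemma exists_mem_vertices_sdiff (h : IsMaxMatching F M) (hA : AreStars F M A c) {E : Finset V}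
    (hE : E ∈ F) (hEc : ∀ e ∈ A, c e ∉ E) : ∃ v ∈ E, v ∈ vertices (M \ A) := by
  classical
  by_contra! hcon
  set R := A.filter fun e => ∃ v ∈ e, v ∈ E with hR
  have hRA : R ⊆ A := Finset.filter_subset _ _
  have hEA : ∀ z ∈ E, z ∈ vertices M → z ∈ vertices R := by
    intro z hz hzM
    obtain ⟨e, he, hze⟩ := mem_vertices.1 hzM
    have heA : e ∈ A := by
      by_contra heA
      exact hcon z hz (mem_vertices.2 ⟨e, Finset.mem_sdiff.2 ⟨he, heA⟩, hze⟩)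
    exact mem_vertices.2 ⟨e, Finset.mem_filter.2 ⟨heA, z, hze, hz⟩, hze⟩
  have hRcard : R.card ≤ (E ∩ vertices M).card := by
    have hex : ∀ e ∈ R, ∃ v ∈ e, v ∈ E := fun e he => (Finset.mem_filter.1 he).2
    have hE0 : E.Nonempty := by rw [← Finset.card_pos, h.card_eq hE]; norm_num
    have : Nonempty V := ⟨hE0.choose⟩
    choose! p hp1 hp2 using hex
    refine Finset.card_le_card_of_injOn p ?_ ?_
    · intro e he
      exact Finset.mem_coe.2 (Finset.mem_inter.2
        ⟨hp2 e he, mem_vertices.2 ⟨e, hA.1 (hRA he), hp1 e he⟩⟩)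
    · intro e he e' he' hpe
      exact h.eq_of_mem (hA.1 (hRA he)) (hA.1 (hRA he')) (hp1 e he) (hpe ▸ hp1 e' he')
  have hsum := Finset.card_sdiff_add_card_inter E (vertices M)
  rw [h.card_eq hE] at hsum
  -- The budget holds: |E \ V(M)| + 2|R| ≤ 3 + |R| ≤ 6. The edge `E` plus one pendant edge for each
  -- star it meets then outnumbers those stars.
  obtain ⟨Q, hQ1, hQ2, hQ3⟩ := h.exists_pendants c R (hRA.trans hA.1) (fun e he => hA.2 e (hRA he))
    (E \ vertices M) Finset.sdiff_disjoint (by omega)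
  have hlen := h.length_le_card (R := R) (Q := E :: Q) (hRA.trans hA.1) (by
      intro E' hE'
      rcases List.mem_cons.1 hE' with rfl | hE'
      · exact hE
      · exact (hQ3 E' hE').1) (by
      refine List.pairwise_cons.2 ⟨fun E' hE' => ?_, hQ2⟩
      obtain ⟨-, hd, hz⟩ := hQ3 E' hE'
      rw [Finset.disjoint_left]
      intro z hzE hzE'
      by_cases hzM : z ∈ vertices M
      · obtain ⟨e, he, rfl⟩ := hz z hzE' hzM
        exact hEc e (hRA he) hzE
      · exact Finset.disjoint_left.1 hd hzE' (Finset.mem_sdiff.2 ⟨hzE, hzM⟩)) (by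
      intro E' hE' z hz hzM
      rcases List.mem_cons.1 hE' with rfl | hE'
      · exact hEA z hz hzM
      · obtain ⟨e, he, rfl⟩ := (hQ3 E' hE').2.2 z hz hzM
        exact mem_vertices.2 ⟨e, he, (hA.2 e (hRA he)).1⟩)
  simp only [List.length_cons] at hlen
  omega

/-- A pendant edge at `v` has only two outer vertices, so one of three pendant edges at `u` misses
it, and the two would replace `e`. -/
lemma pendants_eq_empty (h : IsMaxMatching F M) {e : Finset V} (he : e ∈ M) {u v : V}
    (hu : u ∈ e) (hv : v ∈ e) (huv : u ≠ v) (h3 : 3 ≤ (pendants F M u).card) :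
    (pendants F M v).card = 0 := by
  rw [Finset.card_eq_zero, Finset.eq_empty_iff_forall_notMem]
  intro E hE
  rw [pendants, Finset.mem_filter] at hE
  have huM : u ∈ vertices M := mem_vertices.2 ⟨e, he, hu⟩
  have hvM : v ∈ vertices M := mem_vertices.2 ⟨e, he, hv⟩
  have hEM : ∀ z ∈ E, z ∈ vertices M → z = v := fun z hz hzM =>
    Finset.mem_singleton.1 (hE.2 ▸ Finset.mem_inter.2 ⟨hz, hzM⟩)
  have hvE : v ∈ E := (Finset.mem_inter.1 (hE.2 ▸ Finset.mem_singleton_self v)).1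
  obtain ⟨E', hE', hd⟩ := h.exists_pendant_disjoint (v := u) (X := E.erase v)
    (fun hu' => huv (hEM u (Finset.mem_of_mem_erase hu') huM))
    (by rw [Finset.card_erase_of_mem hvE, h.card_eq hE.1]; omega)
  rw [pendants, Finset.mem_filter] at hE'
  have hEM' : ∀ z ∈ E', z ∈ vertices M → z = u := fun z hz hzM =>
    Finset.mem_singleton.1 (hE'.2 ▸ Finset.mem_inter.2 ⟨hz, hzM⟩)
  have hlen := h.length_le_card (R := {e}) (Q := [E, E']) (by simpa using he) (by
      intro B hB
      simp only [List.mem_cons, List.not_mem_nil, or_false] at hB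
      rcases hB with rfl | rfl
      exacts [hE.1, hE'.1]) (by
      simp only [List.pairwise_cons, List.mem_cons, List.not_mem_nil, or_false,
        forall_eq, IsEmpty.forall_iff, implies_true, List.Pairwise.nil, and_true]
      rw [Finset.disjoint_left]
      intro z hz hz'
      by_cases hzv : z = v
      · exact huv ((hzv.symm.trans (hEM' z hz' (hzv ▸ hvM))).symm)
      · exact Finset.disjoint_left.1 hd hz' (Finset.mem_erase.2 ⟨hzv, hz⟩)) (by
      intro B hB z hz hzM
      simp only [List.mem_cons, List.not_mem_nil, or_false] at hB
      refine mem_vertices.2 ⟨e, by simp, ?_⟩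
      rcases hB with rfl | rfl
      · exact hEM z hz hzM ▸ hv
      · exact hEM' z hz hzM ▸ hu)
  simp at hlen

/-- Either one vertex has 3 or 4 pendant edges and the others none, or all three have at most 2. -/
lemma sum_pendants_le (h : IsMaxMatching F M) {e : Finset V} (he : e ∈ M)
    (h4 : ∀ v ∈ e, (pendants F M v).card ≤ 4) : ∑ v ∈ e, (pendants F M v).card ≤ 6 := by
  obtain ⟨u, v, w, huv, huw, hvw, rfl⟩ := Finset.card_eq_three.1 (h.card_eq (h.subset he))
  rw [Finset.sum_insert (by simp [huv, huw]), Finset.sum_pair hvw]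
  have a1 := h4 u (by simp)
  have a2 := h4 v (by simp)
  have a3 := h4 w (by simp)
  have b1 := h.pendants_eq_empty he (u := u) (v := v) (by simp) (by simp) huv
  have b2 := h.pendants_eq_empty he (u := u) (v := w) (by simp) (by simp) huw
  have b3 := h.pendants_eq_empty he (u := v) (v := u) (by simp) (by simp) huv.symm
  have b4 := h.pendants_eq_empty he (u := v) (v := w) (by simp) (by simp) hvw
  have b5 := h.pendants_eq_empty he (u := w) (v := u) (by simp) (by simp) huw.symm
  have b6 := h.pendants_eq_empty he (u := w) (v := v) (by simp) (by simp) hvw.symm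
  omega

/-- With different colours, the two cross edges and a pendant edge at the centre of `e` would
replace `e` and `f`. -/
lemma color_eq_of_star (h : IsMaxMatching F M) (hA : AreStars F M A c) {e f : Finset V}
    (he : e ∈ A) (hf : f ∈ M) (hef : e ≠ f) {b b' v v' x y : V} (hb : b ∈ e) (hb' : b' ∈ e)
    (hbc : b ≠ c e) (hbc' : b' ≠ c e) (hbb : b ≠ b') (hv : v ∈ f) (hv' : v' ∈ f) (hvv : v ≠ v')
    (h1 : IsCrossEdge F M b v x) (h2 : IsCrossEdge F M b' v' y) : x = y := by
  by_contra hxy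
  have heM := hA.1 he
  obtain ⟨hce, -⟩ := hA.2 e he
  have hne : ∀ p ∈ e, ∀ q ∈ f, p ≠ q := fun p hp q hq => h.ne_of_mem heM hf hef hp hq
  obtain ⟨Q, hQ1, hQ2, hQ3⟩ := h.exists_pendants c {e} (by simpa using heM)
    (by simpa using hA.2 e he) {x, y} (by
      rw [Finset.disjoint_left]
      intro z hz
      simp only [Finset.mem_insert, Finset.mem_singleton] at hz
      rcases hz with rfl | rfl
      exacts [h1.2.2.1, h2.2.2.1]) (by rw [Finset.card_pair hxy]; simp)
  have hdis : ∀ p ∈ e, p ≠ c e → ∀ q ∈ f, ∀ t ∈ ({x, y} : Finset V), IsCrossEdge F M p q t →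
      ∀ E ∈ Q, Disjoint ({p, q, t} : Finset V) E := by
    intro p hp hpc q hq t ht hpq E hE
    obtain ⟨-, hd, hz⟩ := hQ3 E hE
    rw [Finset.disjoint_left]
    intro z hz1 hz2
    by_cases hzM : z ∈ vertices M
    · obtain ⟨e', he', rfl⟩ := hz z hz2 hzM
      rw [Finset.mem_singleton] at he'
      subst he'
      rcases hpq.mem_or hz1 hzM with h' | h'
      · exact hpc h'.symm
      · exact hne _ hce _ hq h'
    · have hzt : z = t := by
        simp only [Finset.mem_insert, Finset.mem_singleton] at hz1
        rcases hz1 with rfl | rfl | rfl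
        exacts [absurd hpq.1 hzM, absurd hpq.2.1 hzM, rfl]
      exact Finset.disjoint_left.1 hd hz2 (hzt ▸ ht)
  have hlen := h.length_le_card (R := {e, f}) (Q := {b, v, x} :: {b', v', y} :: Q)
    (by intro z hz; simp only [Finset.mem_insert, Finset.mem_singleton] at hz
        rcases hz with rfl | rfl <;> assumption)
    (by
      intro E hE
      simp only [List.mem_cons] at hE
      rcases hE with rfl | rfl | hE
      exacts [h1.2.2.2, h2.2.2.2, (hQ3 E hE).1])
    (by
      refine List.pairwise_cons.2 ⟨fun E hE => ?_, List.pairwise_cons.2 ⟨fun E hE => ?_, hQ2⟩⟩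
      · rcases List.mem_cons.1 hE with rfl | hE
        · exact h1.disjoint h2 hbb (hne _ hb _ hv') (hne _ hb' _ hv).symm hvv hxy
        · exact hdis b hb hbc v hv x (by simp) h1 E hE
      · exact hdis b' hb' hbc' v' hv' y (by simp) h2 E hE)
    (by
      intro E hE z hz hzM
      simp only [List.mem_cons] at hE
      rw [mem_vertices]
      rcases hE with rfl | rfl | hE
      · rcases h1.mem_or hz hzM with rfl | rfl
        exacts [⟨e, by simp, hb⟩, ⟨f, by simp, hv⟩]
      · rcases h2.mem_or hz hzM with rfl | rfl
        exacts [⟨e, by simp, hb'⟩, ⟨f, by simp, hv'⟩]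
      · obtain ⟨e', he', rfl⟩ := (hQ3 E hE).2.2 z hz hzM
        rw [Finset.mem_singleton] at he'
        exact ⟨e, by simp, he' ▸ hce⟩)
  rw [Finset.card_pair hef] at hlen
  simp only [List.length_cons, hQ1, Finset.card_singleton] at hlen
  omega

/-- The mixed edge, the cross edge and pendant edges at the centres of both stars involved would be
four disjoint edges replacing three members. -/
lemma not_isMixed_of_cross (h : IsMaxMatching F M) (hA : AreStars F M A c) {e f : Finset V}
    (he : e ∈ A) (hf : f ∈ M \ A) {b b' v v' x : V} (hb : b ∈ e) (hb' : b' ∈ e)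
    (hbc : b ≠ c e) (hbc' : b' ≠ c e) (hbb : b ≠ b') (hv : v ∈ f) (hv' : v' ∈ f) (hvv : v ≠ v')
    (h2 : IsCrossEdge F M b' v' x) : ¬ IsMixed F A c e b v := by
  rintro ⟨e', he', hee, w, hw, hwc, hE⟩
  rw [Finset.mem_sdiff] at hf
  obtain ⟨hf, hfA⟩ := hf
  have heM := hA.1 he
  have heM' := hA.1 he'
  have hef : e ≠ f := by rintro rfl; exact hfA he
  have hef' : e' ≠ f := by rintro rfl; exact hfA he'
  have hce := (hA.2 e he).1
  have hce' := (hA.2 e' he').1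
  have hne : ∀ p ∈ e, ∀ q ∈ f, p ≠ q := fun p hp q hq => h.ne_of_mem heM hf hef hp hq
  have hne' : ∀ p ∈ e', ∀ q ∈ f, p ≠ q := fun p hp q hq => h.ne_of_mem heM' hf hef' hp hq
  have hne2 : ∀ p ∈ e', ∀ q ∈ e, p ≠ q := fun p hp q hq => h.ne_of_mem heM' heM hee hp hq
  obtain ⟨Q, hQ1, hQ2, hQ3⟩ := h.exists_pendants c {e, e'}
    (by intro z hz; simp only [Finset.mem_insert, Finset.mem_singleton] at hz
        rcases hz with rfl | rfl <;> assumption)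
    (by intro z hz; simp only [Finset.mem_insert, Finset.mem_singleton] at hz
        rcases hz with rfl | rfl
        exacts [hA.2 _ he, hA.2 _ he']) {x} (by simpa using h2.2.2.1)
    (by rw [Finset.card_pair hee.symm]; simp)
  have hM1 : ∀ z ∈ ({b, v, w} : Finset V), z ∈ vertices M := by
    intro z hz
    simp only [Finset.mem_insert, Finset.mem_singleton] at hz
    rcases hz with rfl | rfl | rfl
    exacts [mem_vertices.2 ⟨e, heM, hb⟩, mem_vertices.2 ⟨f, hf, hv⟩, mem_vertices.2 ⟨e', heM', hw⟩]
  have hlen := h.length_le_card (R := {e, e', f}) (Q := {b, v, w} :: {b', v', x} :: Q)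
    (by intro z hz; simp only [Finset.mem_insert, Finset.mem_singleton] at hz
        rcases hz with rfl | rfl | rfl <;> assumption)
    (by
      intro E hE'
      simp only [List.mem_cons] at hE'
      rcases hE' with rfl | rfl | hE'
      exacts [hE, h2.2.2.2, (hQ3 E hE').1])
    (by
      refine List.pairwise_cons.2 ⟨fun E hE => ?_, List.pairwise_cons.2 ⟨fun E hE => ?_, hQ2⟩⟩
      · rw [Finset.disjoint_left]
        intro z hz1 hz2
        have hzM := hM1 z hz1
        simp only [Finset.mem_insert, Finset.mem_singleton] at hz1
        rcases List.mem_cons.1 hE with rfl | hE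
        · rcases h2.mem_or hz2 hzM with rfl | rfl
          · rcases hz1 with h' | h' | h'
            exacts [hbb h'.symm, hne _ hb' _ hv h', hne2 _ hw _ hb' h'.symm]
          · rcases hz1 with h' | h' | h'
            exacts [hne _ hb _ hv' h'.symm, hvv h'.symm, hne' _ hw _ hv' h'.symm]
        · obtain ⟨r, hr, rfl⟩ := (hQ3 E hE).2.2 z hz2 hzM
          simp only [Finset.mem_insert, Finset.mem_singleton] at hr
          rcases hr with rfl | rfl
          · rcases hz1 with h' | h' | h'
            exacts [hbc h'.symm, hne _ hce _ hv h', hne2 _ hw _ hce h'.symm]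
          · rcases hz1 with h' | h' | h'
            exacts [hne2 _ hce' _ hb h', hne' _ hce' _ hv h', hwc h'.symm]
      · rw [Finset.disjoint_left]
        intro z hz1 hz2
        obtain ⟨-, hd, hz⟩ := hQ3 E hE
        by_cases hzM : z ∈ vertices M
        · obtain ⟨r, hr, rfl⟩ := hz z hz2 hzM
          simp only [Finset.mem_insert, Finset.mem_singleton] at hr
          rcases h2.mem_or hz1 hzM with h' | h' <;> rcases hr with rfl | rfl
          exacts [hbc' h'.symm, hne2 _ hce' _ hb' h', hne _ hce _ hv' h', hne' _ hce' _ hv' h']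
        · have hzt : z = x := by
            simp only [Finset.mem_insert, Finset.mem_singleton] at hz1
            rcases hz1 with rfl | rfl | rfl
            exacts [absurd h2.1 hzM, absurd h2.2.1 hzM, rfl]
          exact Finset.disjoint_left.1 hd hz2 (by simp [hzt]))
    (by
      intro E hE z hz hzM
      simp only [List.mem_cons] at hE
      rw [mem_vertices]
      rcases hE with rfl | rfl | hE
      · simp only [Finset.mem_insert, Finset.mem_singleton] at hz
        rcases hz with rfl | rfl | rfl
        exacts [⟨e, by simp, hb⟩, ⟨f, by simp, hv⟩, ⟨e', by simp, hw⟩]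
      · rcases h2.mem_or hz hzM with rfl | rfl
        exacts [⟨e, by simp, hb'⟩, ⟨f, by simp, hv'⟩]
      · obtain ⟨r, hr, rfl⟩ := (hQ3 E hE).2.2 z hz hzM
        simp only [Finset.mem_insert, Finset.mem_singleton] at hr
        rcases hr with rfl | rfl
        exacts [⟨_, by simp, hce⟩, ⟨_, by simp, hce'⟩])
  have := Finset.card_le_three (a := e) (b := e') (c := f)
  simp only [List.length_cons, hQ1, Finset.card_pair hee.symm] at hlen
  omega

lemma not_cross_of_isMixed (h : IsMaxMatching F M) (hA : AreStars F M A c) {e f : Finset V}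
    (he : e ∈ A) (hf : f ∈ M \ A) {b v x : V} (hb : b ∈ e) (hv : v ∈ f)
    (hm : IsMixed F A c e b v) : ¬ IsCrossEdge F M b v x := by
  intro hx
  obtain ⟨e', he', hee, w, hw, -, hE⟩ := hm
  rw [Finset.mem_sdiff] at hf
  have hef' : e' ≠ f := by rintro rfl; exact hf.2 he'
  have heq := h.linear.eq_of_mem hE hx.2.2.2 (h.cross_ne hx) (by simp) (by simp) (by simp) (by simp)
  have hw' : w ∈ ({b, v, x} : Finset V) := by rw [← heq]; simp
  rcases hx.mem_or hw' (mem_vertices.2 ⟨e', hA.1 he', hw⟩) with h' | h'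
  · exact h.ne_of_mem (hA.1 he') (hA.1 he) hee hw hb h'
  · exact h.ne_of_mem (hA.1 he') hf.1 hef' hw hv h'

/-- If `b'` were joined to two vertices of `f`, the edge from `b` to the third would have to share
its colour with both, though they differ. -/
lemma crossDegree_le_one_of_star (h : IsMaxMatching F M) (hA : AreStars F M A c) {e f : Finset V}
    (he : e ∈ A) (hf : f ∈ M) (hef : e ≠ f) {b b' : V} (hb : b ∈ e) (hb' : b' ∈ e)
    (hbc : b ≠ c e) (hbc' : b' ≠ c e) (hbb : b ≠ b') (h3 : 3 ≤ crossDegree F M b f) :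
    crossDegree F M b' f ≤ 1 := by
  classical
  by_contra! hcon
  have hf3 := h.card_eq (h.subset hf)
  obtain ⟨v, hv, v', hv', hvv⟩ := Finset.one_lt_card.1 (show 1 < (f.filter fun k =>
      ∃ x, IsCrossEdge F M b' k x).card from hcon)
  rw [Finset.mem_filter] at hv hv'
  obtain ⟨hv, x, hx⟩ := hv
  obtain ⟨hv', y, hy⟩ := hv'
  obtain ⟨w, hw, hwv⟩ : ∃ w ∈ f, w ∉ ({v, v'} : Finset V) := by
    by_contra! hsub
    have := Finset.card_le_card (show f ⊆ {v, v'} from hsub)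
    rw [Finset.card_pair hvv] at this
    omega
  simp only [Finset.mem_insert, Finset.mem_singleton, not_or] at hwv
  obtain ⟨z, hz⟩ := forall_cross_of_card_le (F := F) (M := M) (u := b) (G := f) (by omega) w hw
  have e1 := h.color_eq_of_star hA he hf hef hb hb' hbc hbc' hbb hw hv hwv.1 hz hx
  have e2 := h.color_eq_of_star hA he hf hef hb hb' hbc hbc' hbb hw hv' hwv.2 hz hy
  exact h.color_ne_of_left hx hy hvv (e1.symm.trans e2)

/-- The mixed pair itself is not a cross pair, leaving at most two at `b`; at `b'` only `v` can be
used. -/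
lemma crossDegree_of_isMixed (h : IsMaxMatching F M) (hA : AreStars F M A c) {e f : Finset V}
    (he : e ∈ A) (hf : f ∈ M \ A) {b b' v : V} (hb : b ∈ e) (hb' : b' ∈ e)
    (hbc : b ≠ c e) (hbc' : b' ≠ c e) (hbb : b ≠ b') (hv : v ∈ f) (hm : IsMixed F A c e b v) :
    crossDegree F M b f + crossDegree F M b' f ≤ 3 := by
  classical
  have hf3 := h.card_eq (h.subset (Finset.mem_sdiff.1 hf).1)
  have h1 : crossDegree F M b f ≤ 2 := by
    by_contra! hcon
    obtain ⟨z, hz⟩ := forall_cross_of_card_le (F := F) (M := M) (u := b) (G := f) (by omega) v hv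
    exact h.not_cross_of_isMixed hA he hf hb hv hm hz
  have h2 : crossDegree F M b' f ≤ 1 := by
    have hsub : (f.filter fun g => ∃ x, IsCrossEdge F M b' g x) ⊆ {v} := by
      intro v' hv'
      rw [Finset.mem_filter] at hv'
      obtain ⟨hv', x, hx⟩ := hv'
      rw [Finset.mem_singleton]
      by_contra hvv
      exact h.not_isMixed_of_cross hA he hf hb hb' hbc hbc' hbb hv hv' (Ne.symm hvv) hx hm
    exact (Finset.card_le_card hsub).trans (by simp)
  omega

end IsMaxMatching

/-! ### Discharging: weights of pairs -/

open scoped Classical in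
/-- The weight of a pair joining a non-central vertex of the star `e` to a vertex outside the
stars. -/
noncomputable def starWeight (F M A : Finset (Finset V)) (c : Finset V → V) (e : Finset V)
    (u v : V) : ℕ :=
  if ∃ x, IsCrossEdge F M u v x then 12 else if IsMixed F A c e u v then 6 else 4

/-- With a mixed pair there are at most 3 cross pairs, so the weight is at most 6·6 + 6·3 = 54.
Without one there are at most 4 (as 3 + 1 or 2 + 2), giving 6·4 + 8·4 = 56. -/
lemma IsMaxMatching.sum_starWeight_le {F M A : Finset (Finset V)} {c : Finset V → V}
    (h : IsMaxMatching F M) (hA : AreStars F M A c) {e f : Finset V}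
    (he : e ∈ A) (hf : f ∈ M \ A) :
    ∑ u ∈ e.erase (c e), ∑ v ∈ f, starWeight F M A c e u v ≤ 56 := by
  classical
  have hfM := (Finset.mem_sdiff.1 hf).1
  have hef : e ≠ f := by rintro rfl; exact (Finset.mem_sdiff.1 hf).2 he
  have hf3 := h.card_eq (h.subset hfM)
  have he2 : (e.erase (c e)).card = 2 := by
    rw [Finset.card_erase_of_mem (hA.2 e he).1, h.card_eq (h.subset (hA.1 he))]
  obtain ⟨b, b', hbb, hee⟩ := Finset.card_eq_two.1 he2
  have hb : b ≠ c e ∧ b ∈ e := Finset.mem_erase.1 (by rw [hee]; simp)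
  have hb' : b' ≠ c e ∧ b' ∈ e := Finset.mem_erase.1 (by rw [hee]; simp)
  have hrow : ∀ (s t : ℕ) (u : V), (∀ v ∈ f, starWeight F M A c e u v ≤
      s + t * (if ∃ x, IsCrossEdge F M u v x then 1 else 0)) →
      ∑ v ∈ f, starWeight F M A c e u v ≤ 3 * s + t * crossDegree F M u f := by
    intro s t u hu
    refine (Finset.sum_le_sum hu).trans (le_of_eq ?_)
    rw [Finset.sum_add_distrib, ← Finset.mul_sum, Finset.sum_const, hf3, crossDegree,
      Finset.card_filter, smul_eq_mul]
  rw [hee, Finset.sum_pair hbb]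
  by_cases hmix : ∃ u ∈ e.erase (c e), ∃ v ∈ f, IsMixed F A c e u v
  · have hw : ∀ u, ∀ v ∈ f, starWeight F M A c e u v ≤
        6 + 6 * (if ∃ x, IsCrossEdge F M u v x then 1 else 0) := by
      intro u v _
      unfold starWeight
      split_ifs <;> omega
    have h1 := hrow 6 6 b (hw b)
    have h2 := hrow 6 6 b' (hw b')
    have h3 : crossDegree F M b f + crossDegree F M b' f ≤ 3 := by
      obtain ⟨u, hu, v, hv, hm⟩ := hmix
      rw [hee] at hu
      simp only [Finset.mem_insert, Finset.mem_singleton] at hu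
      rcases hu with rfl | rfl
      · exact h.crossDegree_of_isMixed hA he hf hb.2 hb'.2 hb.1 hb'.1 hbb hv hm
      · rw [add_comm]
        exact h.crossDegree_of_isMixed hA he hf hb'.2 hb.2 hb'.1 hb.1 hbb.symm hv hm
    omega
  · push Not at hmix
    have hw : ∀ u ∈ e.erase (c e), ∀ v ∈ f, starWeight F M A c e u v ≤
        4 + 8 * (if ∃ x, IsCrossEdge F M u v x then 1 else 0) := by
      intro u hu v hv
      have := hmix u hu v hv
      unfold starWeight
      split_ifs <;> omega
    have h1 := hrow 4 8 b (hw b (by rw [hee]; simp))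
    have h2 := hrow 4 8 b' (hw b' (by rw [hee]; simp))
    have h3 := h.crossDegree_le_one_of_star hA he hfM hef hb.2 hb'.2 hb.1 hb'.1 hbb
    have h4 := h.crossDegree_le_one_of_star hA he hfM hef hb'.2 hb.2 hb'.1 hb.1 hbb.symm
    have h5 := crossDegree_le F M b f
    have h6 := crossDegree_le F M b' f
    omega

lemma sum_sum_filter_le {α β : Type*} (S : Finset α) (T : Finset β) (r : α → β → Prop)
    [∀ a, DecidablePred (r a)] (w : β → ℕ)
    (h : ∀ b ∈ T, ∀ a ∈ S, ∀ a' ∈ S, r a b → r a' b → a = a') :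
    ∑ a ∈ S, ∑ b ∈ T with r a b, w b ≤ ∑ b ∈ T, w b := by
  classical
  simp only [Finset.sum_filter]
  rw [Finset.sum_comm]
  refine Finset.sum_le_sum fun b hb => ?_
  rw [← Finset.sum_filter, Finset.sum_const, smul_eq_mul]
  have : (S.filter fun a => r a b).card ≤ 1 := by
    rw [Finset.card_le_one]
    intro a ha a' ha'
    rw [Finset.mem_filter] at ha ha'
    exact h b hb a ha.1 a' ha'.1 ha.2 ha'.2
  nlinarith

lemma mul_card_le_sum_filter {β : Type*} {S T : Finset β} {r : β → Prop} [DecidablePred r]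
    {w : β → ℕ} {t : ℕ} (hS : ∀ b ∈ S, b ∈ T ∧ r b ∧ t ≤ w b) :
    S.card * t ≤ ∑ b ∈ T with r b, w b :=
  calc S.card * t ≤ ∑ b ∈ S, w b := by
        rw [← smul_eq_mul]; exact Finset.card_nsmul_le_sum _ _ _ fun b hb => (hS b hb).2.2
    _ ≤ _ := Finset.sum_le_sum_of_subset fun b hb =>
        Finset.mem_filter.2 ⟨(hS b hb).1, (hS b hb).2.1⟩

open scoped Classical in
/-- The weight of a pair of vertices outside the stars. -/
noncomputable def pairWeight (F M : Finset (Finset V)) (u v : V) : ℕ :=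
  if ∃ x, IsCrossEdge F M u v x then 6 else 2

/-- Ordered pairs of vertices in distinct members of `B`, with those members recorded. -/
def outerPairs (B : Finset (Finset V)) : Finset (Σ _ : Finset V × Finset V, V × V) :=
  B.offDiag.sigma fun q => q.1 ×ˢ q.2

/-- Pairs of a non-central vertex of a star and a vertex of a member of `B`. -/
def starPairs (A B : Finset (Finset V)) (c : Finset V → V) :
    Finset (Σ _ : Finset V × Finset V, V × V) :=
  (A ×ˢ B).sigma fun q => q.1.erase (c q.1) ×ˢ q.2

/-- Edges avoiding the centres of the stars that are not in `M` and meet its vertex set in at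
least two points. -/
def heavyEdges (F M A : Finset (Finset V)) (c : Finset V → V) : Finset (Finset V) :=
  F.filter fun E => E ∉ M ∧ (∀ e ∈ A, c e ∉ E) ∧ 2 ≤ (E ∩ vertices M).card

lemma mem_outerPairs {W : Type*} {B : Finset (Finset W)} {e f : Finset W} {u v : W} :
    (⟨(e, f), (u, v)⟩ : Σ _ : Finset W × Finset W, W × W) ∈ outerPairs B ↔
      (e ∈ B ∧ f ∈ B ∧ e ≠ f) ∧ u ∈ e ∧ v ∈ f := by
  simp [outerPairs]

lemma mem_starPairs {A B : Finset (Finset V)} {c : Finset V → V} {e f : Finset V} {u v : V} :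
    (⟨(e, f), (u, v)⟩ : Σ _ : Finset V × Finset V, V × V) ∈ starPairs A B c ↔
      (e ∈ A ∧ f ∈ B) ∧ (u ≠ c e ∧ u ∈ e) ∧ v ∈ f := by
  simp [starPairs]

/-- The total weight of the pairs contained in `E`. -/
noncomputable def edgeWeight (F M A : Finset (Finset V)) (c : Finset V → V) (E : Finset V) : ℕ :=
  (∑ p ∈ outerPairs (M \ A) with p.2.1 ∈ E ∧ p.2.2 ∈ E, pairWeight F M p.2.1 p.2.2) +
    ∑ p ∈ starPairs A (M \ A) c with p.2.1 ∈ E ∧ p.2.2 ∈ E,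
      starWeight F M A c p.1.1 p.2.1 p.2.2

lemma four_le_starWeight (F M A : Finset (Finset V)) (c : Finset V → V) (e : Finset V) (u v : V) :
    4 ≤ starWeight F M A c e u v := by
  unfold starWeight; split_ifs <;> omega

lemma two_le_pairWeight (F M : Finset (Finset V)) (u v : V) : 2 ≤ pairWeight F M u v := by
  unfold pairWeight; split_ifs <;> omega

lemma IsMixed.six_le_starWeight {F M A : Finset (Finset V)} {c : Finset V → V} {e : Finset V}
    {u v : V} (h : IsMixed F A c e u v) : 6 ≤ starWeight F M A c e u v := by
  unfold starWeight; split_ifs <;> omega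

section

variable {F M A : Finset (Finset V)} {c : Finset V → V}

/-- A single pair pays everything: 12 if it involves a star, and otherwise 6 in each of its two
orders. -/
lemma IsCrossEdge.twelve_le_edgeWeight {u w x : V} {e g E : Finset V}
    (hx : IsCrossEdge F M u w x) (he : e ∈ M) (hg : g ∈ M \ A) (heg : e ≠ g) (hu : u ∈ e)
    (hw : w ∈ g) (huc : e ∈ A → u ≠ c e) (huE : u ∈ E) (hwE : w ∈ E) :
    12 ≤ edgeWeight F M A c E := by
  by_cases heA : e ∈ A
  · refine le_trans ?_ (Nat.le_add_left _ _)
    refine le_trans ?_ (mul_card_le_sum_filter (S := {⟨(e, g), (u, w)⟩}) (t := 12) ?_)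
    · simp
    · intro p hp
      rw [Finset.mem_singleton] at hp
      subst hp
      refine ⟨mem_starPairs.2 ⟨⟨heA, hg⟩, ⟨huc heA, hu⟩, hw⟩, ⟨huE, hwE⟩, ?_⟩
      have : ∃ x, IsCrossEdge F M u w x := ⟨x, hx⟩
      simp [starWeight, this]
  · have heB : e ∈ M \ A := Finset.mem_sdiff.2 ⟨he, heA⟩
    refine le_trans ?_ (Nat.le_add_right _ _)
    refine le_trans ?_ (mul_card_le_sum_filter
      (S := {⟨(e, g), (u, w)⟩, ⟨(g, e), (w, u)⟩}) (t := 6) ?_)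
    · rw [Finset.card_pair (by simp [heg])]
    · intro p hp
      have h1 : ∃ x, IsCrossEdge F M u w x := ⟨x, hx⟩
      have h2 : ∃ x, IsCrossEdge F M w u x := ⟨x, hx.symm⟩
      simp only [Finset.mem_insert, Finset.mem_singleton] at hp
      rcases hp with rfl | rfl
      · exact ⟨mem_outerPairs.2 ⟨⟨heB, hg, heg⟩, hu, hw⟩, ⟨huE, hwE⟩, by simp [pairWeight, h1]⟩
      · exact ⟨mem_outerPairs.2 ⟨⟨hg, heB, heg.symm⟩, hw, hu⟩, ⟨hwE, huE⟩,
          by simp [pairWeight, h2]⟩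

/-- The payment is 2 + 2 from the two orders of the outer pair and 4 + 4 from the star pairs. -/
lemma twelve_le_edgeWeight_of_star {u v w : V} {e f g E : Finset V} (he : e ∈ A)
    (hf : f ∈ M \ A) (hg : g ∈ M \ A) (hfg : f ≠ g)
    (hu : u ∈ e) (hv : v ∈ f) (hw : w ∈ g) (huc : u ≠ c e)
    (huE : u ∈ E) (hvE : v ∈ E) (hwE : w ∈ E) : 12 ≤ edgeWeight F M A c E := by
  refine le_trans ?_ (Nat.add_le_add
    (mul_card_le_sum_filter (S := {⟨(f, g), (v, w)⟩, ⟨(g, f), (w, v)⟩}) (t := 2) ?_)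
    (mul_card_le_sum_filter (S := {⟨(e, f), (u, v)⟩, ⟨(e, g), (u, w)⟩}) (t := 4) ?_))
  · rw [Finset.card_pair (by simp [hfg]), Finset.card_pair (by simp [hfg])]
  · intro p hp
    simp only [Finset.mem_insert, Finset.mem_singleton] at hp
    rcases hp with rfl | rfl
    · exact ⟨mem_outerPairs.2 ⟨⟨hf, hg, hfg⟩, hv, hw⟩, ⟨hvE, hwE⟩, two_le_pairWeight _ _ _ _⟩
    · exact ⟨mem_outerPairs.2 ⟨⟨hg, hf, hfg.symm⟩, hw, hv⟩, ⟨hwE, hvE⟩, two_le_pairWeight _ _ _ _⟩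
  · intro p hp
    simp only [Finset.mem_insert, Finset.mem_singleton] at hp
    rcases hp with rfl | rfl
    · exact ⟨mem_starPairs.2 ⟨⟨he, hf⟩, ⟨huc, hu⟩, hv⟩, ⟨huE, hvE⟩, four_le_starWeight _ _ _ _ _ _ _⟩
    · exact ⟨mem_starPairs.2 ⟨⟨he, hg⟩, ⟨huc, hu⟩, hw⟩, ⟨huE, hwE⟩, four_le_starWeight _ _ _ _ _ _ _⟩

/-- Two stars give two mixed pairs, 6 + 6; one star gives 2 + 2 + 4 + 4; no star gives six ordered
pairs of weight 2. -/
lemma twelve_le_edgeWeight_of_inner {u v w : V} {e f g E : Finset V} (he : e ∈ M) (hf : f ∈ M)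
    (hg : g ∈ M \ A) (hef : e ≠ f) (heg : e ≠ g) (hfg : f ≠ g)
    (hu : u ∈ e) (hv : v ∈ f) (hw : w ∈ g) (huc : e ∈ A → u ≠ c e) (hvc : f ∈ A → v ≠ c f)
    (hE : E ∈ F) (hEeq : E = {w, u, v}) : 12 ≤ edgeWeight F M A c E := by
  have huE : u ∈ E := by simp [hEeq]
  have hvE : v ∈ E := by simp [hEeq]
  have hwE : w ∈ E := by simp [hEeq]
  by_cases heA : e ∈ A <;> by_cases hfA : f ∈ A
  · refine le_trans ?_ (Nat.le_add_left _ _)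
    refine le_trans ?_ (mul_card_le_sum_filter
      (S := {⟨(e, g), (u, w)⟩, ⟨(f, g), (v, w)⟩}) (t := 6) ?_)
    · rw [Finset.card_pair (by simp [hef])]
    · intro p hp
      have h1 : IsMixed F A c e u w := ⟨f, hfA, hef.symm, v, hv, hvc hfA, by
        rw [Finset.insert_comm, ← hEeq]; exact hE⟩
      have h2 : IsMixed F A c f v w := ⟨e, heA, hef, u, hu, huc heA, by
        rw [Finset.insert_comm, Finset.pair_comm, ← hEeq]; exact hE⟩
      simp only [Finset.mem_insert, Finset.mem_singleton] at hp
      rcases hp with rfl | rfl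
      · exact ⟨mem_starPairs.2 ⟨⟨heA, hg⟩, ⟨huc heA, hu⟩, hw⟩, ⟨huE, hwE⟩, h1.six_le_starWeight⟩
      · exact ⟨mem_starPairs.2 ⟨⟨hfA, hg⟩, ⟨hvc hfA, hv⟩, hw⟩, ⟨hvE, hwE⟩, h2.six_le_starWeight⟩
  · exact twelve_le_edgeWeight_of_star heA (Finset.mem_sdiff.2 ⟨hf, hfA⟩) hg hfg hu hv hw
      (huc heA) huE hvE hwE
  · exact twelve_le_edgeWeight_of_star hfA (Finset.mem_sdiff.2 ⟨he, heA⟩) hg heg hv hu hw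
      (hvc hfA) hvE huE hwE
  · have heB : e ∈ M \ A := Finset.mem_sdiff.2 ⟨he, heA⟩
    have hfB : f ∈ M \ A := Finset.mem_sdiff.2 ⟨hf, hfA⟩
    refine le_trans ?_ (Nat.le_add_right _ _)
    refine le_trans ?_ (mul_card_le_sum_filter
      (S := {⟨(e, f), (u, v)⟩, ⟨(f, e), (v, u)⟩, ⟨(e, g), (u, w)⟩, ⟨(g, e), (w, u)⟩,
        ⟨(f, g), (v, w)⟩, ⟨(g, f), (w, v)⟩}) (t := 2) ?_)
    · simp [hef, heg, hfg, hef.symm, heg.symm, hfg.symm]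
    · intro p hp
      have hfe := hef.symm
      have hge := heg.symm
      have hgf := hfg.symm
      simp only [Finset.mem_insert, Finset.mem_singleton] at hp
      rcases hp with rfl | rfl | rfl | rfl | rfl | rfl <;>
        exact ⟨mem_outerPairs.2 ⟨⟨by assumption, by assumption, by assumption⟩, by assumption, by assumption⟩,
          ⟨by assumption, by assumption⟩, two_le_pairWeight _ _ _ _⟩

end

namespace IsMaxMatching

variable {F M A : Finset (Finset V)} {c : Finset V → V}

lemma twelve_le_edgeWeight (h : IsMaxMatching F M) (hA : AreStars F M A c) {E : Finset V}
    (hE : E ∈ heavyEdges F M A c) : 12 ≤ edgeWeight F M A c E := by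
  rw [heavyEdges, Finset.mem_filter] at hE
  obtain ⟨hEF, hEM, hEc, h2⟩ := hE
  obtain ⟨w, hwE, hwB⟩ := h.exists_mem_vertices_sdiff hA hEF hEc
  obtain ⟨g, hg, hwg⟩ := mem_vertices.1 hwB
  have hgM := (Finset.mem_sdiff.1 hg).1
  have hwM : w ∈ vertices M := mem_vertices.2 ⟨g, hgM, hwg⟩
  have hedge : ∀ u ∈ E, ∀ v ∈ E, u ≠ v → ∀ e ∈ M, ∀ f ∈ M, u ∈ e → v ∈ f → e ≠ f := by
    rintro u hu v hv huv e he f hf hue hvf rfl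
    exact hEM (h.linear.eq_of_mem hEF (h.subset he) huv hu hv hue hvf ▸ he)
  have hcent : ∀ u ∈ E, ∀ e ∈ A, u ≠ c e := by
    rintro u hu e he rfl
    exact hEc e he hu
  obtain ⟨u, v, hwu, hwv, huv, hEeq⟩ := card_eq_three_of_mem (h.card_eq hEF) hwE
  have huE : u ∈ E := by simp [hEeq]
  have hvE : v ∈ E := by simp [hEeq]
  by_cases huM : u ∈ vertices M <;> by_cases hvM : v ∈ vertices M
  · obtain ⟨e, he, hue⟩ := mem_vertices.1 huM
    obtain ⟨f, hf, hvf⟩ := mem_vertices.1 hvM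
    exact twelve_le_edgeWeight_of_inner he hf hg (hedge u huE v hvE huv e he f hf hue hvf)
      (hedge u huE w hwE hwu.symm e he g hgM hue hwg)
      (hedge v hvE w hwE hwv.symm f hf g hgM hvf hwg) hue hvf hwg (hcent u huE e) (hcent v hvE f)
      hEF hEeq
  · obtain ⟨e, he, hue⟩ := mem_vertices.1 huM
    have hx : IsCrossEdge F M u w v := ⟨huM, hwM, hvM, by
      rw [Finset.insert_comm, ← hEeq]; exact hEF⟩
    exact hx.twelve_le_edgeWeight he hg (hedge u huE w hwE hwu.symm e he g hgM hue hwg) hue hwg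
      (hcent u huE e) huE hwE
  · obtain ⟨f, hf, hvf⟩ := mem_vertices.1 hvM
    have hx : IsCrossEdge F M v w u := ⟨hvM, hwM, huM, by
      rw [Finset.insert_comm, Finset.pair_comm, ← hEeq]; exact hEF⟩
    exact hx.twelve_le_edgeWeight hf hg (hedge v hvE w hwE hwv.symm f hf g hgM hvf hwg) hvf hwg
      (hcent v hvE f) hvE hwE
  · have : E ∩ vertices M ⊆ {w} := by
      intro z hz
      rw [Finset.mem_inter, hEeq] at hz
      simp only [Finset.mem_insert, Finset.mem_singleton] at hz ⊢
      rcases hz with ⟨rfl | rfl | rfl, hz⟩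
      exacts [rfl, absurd hz huM, absurd hz hvM]
    have := Finset.card_le_card this
    rw [Finset.card_singleton] at this
    omega

/-- The triple bound is averaged over all ordered triples of `B`, degenerate ones included. -/
lemma sum_crossCount_le (h : IsMaxMatching F M) {B : Finset (Finset V)} (hB : B ⊆ M) :
    (∑ q ∈ B.offDiag, crossCount F M q.1 q.2) + 5 * B.card ≤ 7 * B.card ^ 2 := by
  classical
  rcases B.eq_empty_or_nonempty with rfl | hne
  · simp
  set s : Finset V → Finset V → ℕ := fun e f => if e = f then 0 else crossCount F M e f with hs
  set S := ∑ e ∈ B, ∑ f ∈ B, s e f with hS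
  have hoff : ∑ q ∈ B.offDiag, crossCount F M q.1 q.2 = S := by
    rw [hS, ← Finset.sum_product', ← Finset.diag_union_offDiag,
      Finset.sum_union (Finset.disjoint_diag_offDiag _), Finset.sum_eq_zero (s := B.diag), zero_add]
    · refine Finset.sum_congr rfl fun q hq => ?_
      simp [hs, (Finset.mem_offDiag.1 hq).2.2]
    · intro q hq
      simp [hs, (Finset.mem_diag.1 hq).2]
  -- The credit 5 = 21 - 2·8 is the most that keeps the bound 21 for triples with exactly two equal
  -- entries.
  set d : Finset V → Finset V → ℕ := fun e f => if e = f then 5 else 0 with hd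
  have hterm : ∀ e ∈ B, ∀ f ∈ B, ∀ g ∈ B,
      (s e f + s f g + s e g) + (d e f + d f g + d e g) ≤ 21 := by
    intro e he f hf g hg
    have he' := hB he
    have hf' := hB hf
    have hg' := hB hg
    have t1 := h.crossCount_triple_le he' hf' hg'
    have t2 := h.crossCount_le_eight he' hf'
    have t3 := h.crossCount_le_eight hf' hg'
    have t4 := h.crossCount_le_eight he' hg'
    simp only [hs, hd]
    by_cases h1 : e = f
    · subst h1
      by_cases h2 : e = g
      · simp [h2]
      · have := t4 h2
        simp only [if_true, if_neg h2]
        omega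
    · by_cases h2 : e = g
      · subst h2
        have := t2 h1
        rw [crossCount_comm F M f e]
        simp only [if_true, if_neg h1, if_neg (Ne.symm h1)]
        omega
      · by_cases h3 : f = g
        · subst h3
          have := t2 h1
          simp only [if_true, if_neg h1]
          omega
        · have := t1 h1 h2 h3
          simp only [if_neg h1, if_neg h2, if_neg h3]
          omega
  have hsum : ∑ e ∈ B, ∑ f ∈ B, ∑ g ∈ B,
      ((s e f + s f g + s e g) + (d e f + d f g + d e g)) ≤ ∑ e ∈ B, ∑ f ∈ B, ∑ g ∈ B, 21 :=
    Finset.sum_le_sum fun e he => Finset.sum_le_sum fun f hf => Finset.sum_le_sum fun g hg =>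
      hterm e he f hf g hg
  have hD : ∑ e ∈ B, ∑ f ∈ B, d e f = 5 * B.card := by
    simp [hd, mul_comm]
  have hgen : ∀ t : Finset V → Finset V → ℕ, ∑ e ∈ B, ∑ f ∈ B, ∑ g ∈ B,
      (t e f + t f g + t e g) = 3 * (B.card * ∑ e ∈ B, ∑ f ∈ B, t e f) := by
    intro t
    simp only [Finset.sum_add_distrib, Finset.sum_const, smul_eq_mul, ← Finset.mul_sum]
    ring
  have hsplit : ∑ e ∈ B, ∑ f ∈ B, ∑ g ∈ B,
      ((s e f + s f g + s e g) + (d e f + d f g + d e g)) =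
      3 * (B.card * S) + 3 * (B.card * (5 * B.card)) := by
    rw [hS, ← hD, ← hgen s, ← hgen d]
    simp only [← Finset.sum_add_distrib]
  rw [hsplit] at hsum
  simp only [Finset.sum_const, smul_eq_mul] at hsum
  rw [hoff]
  have hpos : 0 < B.card := Finset.card_pos.2 hne
  refine le_of_mul_le_mul_left
    (?_ : 3 * B.card * (S + 5 * B.card) ≤ 3 * B.card * (7 * B.card ^ 2)) (by omega)
  nlinarith

/-- By linearity no pair pays for two edges. -/
lemma sum_edgeWeight_le (h : IsMaxMatching F M) (hA : AreStars F M A c) :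
    ∑ E ∈ heavyEdges F M A c, edgeWeight F M A c E ≤
      (∑ p ∈ outerPairs (M \ A), pairWeight F M p.2.1 p.2.2) +
        ∑ p ∈ starPairs A (M \ A) c, starWeight F M A c p.1.1 p.2.1 p.2.2 := by
  have hheavy : ∀ E ∈ heavyEdges F M A c, E ∈ F := fun E hE => (Finset.mem_filter.1 hE).1
  have hBM : M \ A ⊆ M := Finset.sdiff_subset
  have h1 := sum_sum_filter_le (heavyEdges F M A c) (outerPairs (M \ A))
    (fun E p => p.2.1 ∈ E ∧ p.2.2 ∈ E) (fun p => pairWeight F M p.2.1 p.2.2) (by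
      rintro ⟨⟨e, f⟩, u, v⟩ hp E hE E' hE' hr hr'
      obtain ⟨⟨he, hf, hef⟩, hu, hv⟩ := mem_outerPairs.1 hp
      exact h.linear.eq_of_mem (hheavy E hE) (hheavy E' hE')
        (h.ne_of_mem (hBM he) (hBM hf) hef hu hv) hr.1 hr.2 hr'.1 hr'.2)
  have h2 := sum_sum_filter_le (heavyEdges F M A c) (starPairs A (M \ A) c)
    (fun E p => p.2.1 ∈ E ∧ p.2.2 ∈ E) (fun p => starWeight F M A c p.1.1 p.2.1 p.2.2) (by
      rintro ⟨⟨e, f⟩, u, v⟩ hp E hE E' hE' hr hr'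
      obtain ⟨⟨he, hf⟩, ⟨-, hu⟩, hv⟩ := mem_starPairs.1 hp
      have hef : e ≠ f := by rintro rfl; exact (Finset.mem_sdiff.1 hf).2 he
      exact h.linear.eq_of_mem (hheavy E hE) (hheavy E' hE')
        (h.ne_of_mem (hA.1 he) (hBM hf) hef hu hv) hr.1 hr.2 hr'.1 hr'.2)
  simp only [edgeWeight, Finset.sum_add_distrib]
  exact Nat.add_le_add h1 h2

/-- Each ordered pair of non-stars has weight 9·2 plus 4 per cross pair, in total at most 18(b² - b)
+ 4(7b² - 5b) = 46b² - 38b. -/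
lemma card_heavyEdges_le (h : IsMaxMatching F M) (hA : AreStars F M A c) :
    12 * (heavyEdges F M A c).card + 38 * (M \ A).card ≤
      46 * (M \ A).card ^ 2 + 56 * (A.card * (M \ A).card) := by
  classical
  set B := M \ A with hB
  have hBM : B ⊆ M := Finset.sdiff_subset
  have h1 : 12 * (heavyEdges F M A c).card ≤ ∑ E ∈ heavyEdges F M A c, edgeWeight F M A c E := by
    rw [mul_comm, ← smul_eq_mul]
    exact Finset.card_nsmul_le_sum _ _ _ fun E hE => h.twelve_le_edgeWeight hA hE
  have h2 := h.sum_edgeWeight_le hA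
  rw [← hB] at h2
  have h3 : ∑ p ∈ outerPairs B, pairWeight F M p.2.1 p.2.2 =
      18 * (B.card * B.card - B.card) + 4 * ∑ q ∈ B.offDiag, crossCount F M q.1 q.2 := by
    rw [outerPairs, Finset.sum_sigma, Finset.mul_sum, ← Finset.offDiag_card, mul_comm,
      ← smul_eq_mul, ← Finset.sum_const, ← Finset.sum_add_distrib]
    refine Finset.sum_congr rfl fun q hq => ?_
    obtain ⟨hq1, hq2, -⟩ := Finset.mem_offDiag.1 hq
    have hw : ∀ u v, pairWeight F M u v = 2 + 4 * (if ∃ x, IsCrossEdge F M u v x then 1 else 0) := by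
      intro u v
      unfold pairWeight
      split_ifs <;> rfl
    simp only [Finset.sum_product, hw, Finset.sum_add_distrib, ← Finset.mul_sum, Finset.sum_const,
      smul_eq_mul, Finset.card_product, h.card_eq (h.subset (hBM hq1)), h.card_eq (h.subset (hBM hq2)), crossCount,
      crossDegree, Finset.card_filter]
  have h4 : ∑ p ∈ starPairs A B c, starWeight F M A c p.1.1 p.2.1 p.2.2 ≤
      56 * (A.card * B.card) := by
    rw [starPairs, Finset.sum_sigma, mul_comm, ← Finset.card_product, ← smul_eq_mul]
    refine Finset.sum_le_card_nsmul _ _ _ fun q hq => ?_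
    rw [Finset.mem_product] at hq
    rw [Finset.sum_product]
    exact h.sum_starWeight_le hA hq.1 hq.2
  have h5 := h.sum_crossCount_le hBM
  have h6 : B.card ≤ B.card * B.card := Nat.le_mul_self _
  rw [pow_two] at h5 ⊢
  omega

end IsMaxMatching

/-! ### The edge bound when all degrees are small -/

/-- A linear triple system with matching number `n` and all degrees at most `3 n` has at most
`23 / 6 * (n + 1) ^ 2` edges. -/
lemma IsMaxMatching.card_le {F M : Finset (Finset V)} (h : IsMaxMatching F M)
    (hdeg : ∀ x, degree F x ≤ 3 * M.card) : 12 * F.card ≤ 46 * (M.card + 1) ^ 2 := by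
  classical
  rcases F.eq_empty_or_nonempty with rfl | ⟨E₀, hE₀⟩
  · simp
  have hE0 : E₀.Nonempty := by rw [← Finset.card_pos, h.card_eq hE₀]; norm_num
  have hV : Nonempty V := ⟨hE0.choose⟩
  set A := M.filter fun e => ∃ v ∈ e, 5 ≤ (pendants F M v).card with hAdef
  have hex : ∀ e ∈ A, ∃ v, v ∈ e ∧ 5 ≤ (pendants F M v).card := fun e he =>
    (Finset.mem_filter.1 he).2
  choose! c hc using hex
  have hA : AreStars F M A c := ⟨Finset.filter_subset _ _, hc⟩
  have hB4 : ∀ e ∈ M \ A, ∀ v ∈ e, (pendants F M v).card ≤ 4 := by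
    intro e he v hv
    rw [Finset.mem_sdiff] at he
    by_contra! hcon
    exact he.2 (Finset.mem_filter.2 ⟨he.1, v, hv, hcon⟩)
  have hcover : F ⊆ (A.biUnion fun e => F.filter fun E => c e ∈ E) ∪ (M \ A) ∪
      ((M \ A).biUnion fun e => e.biUnion (pendants F M)) ∪ heavyEdges F M A c := by
    intro E hE
    by_cases hEc : ∃ e ∈ A, c e ∈ E
    · obtain ⟨e, he, hce⟩ := hEc
      simp only [Finset.mem_union, Finset.mem_biUnion, Finset.mem_filter]
      exact Or.inl (Or.inl (Or.inl ⟨e, he, hE, hce⟩))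
    push Not at hEc
    by_cases hEM : E ∈ M
    · have : E ∈ M \ A := Finset.mem_sdiff.2 ⟨hEM, fun hEA => hEc E hEA (hc E hEA).1⟩
      simp only [Finset.mem_union]
      exact Or.inl (Or.inl (Or.inr this))
    by_cases h2 : 2 ≤ (E ∩ vertices M).card
    · exact Finset.mem_union_right _ (Finset.mem_filter.2 ⟨hE, hEM, hEc, h2⟩)
    · obtain ⟨v, hvE, hvB⟩ := h.exists_mem_vertices_sdiff hA hE hEc
      obtain ⟨g, hg, hvg⟩ := mem_vertices.1 hvB
      have hv : v ∈ E ∩ vertices M :=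
        Finset.mem_inter.2 ⟨hvE, mem_vertices.2 ⟨g, (Finset.mem_sdiff.1 hg).1, hvg⟩⟩
      have hEv : E ∩ vertices M = {v} := by
        refine (Finset.eq_of_subset_of_card_le (Finset.singleton_subset_iff.2 hv) ?_).symm
        rw [Finset.card_singleton]
        omega
      refine Finset.mem_union_left _ (Finset.mem_union_right _ ?_)
      exact Finset.mem_biUnion.2 ⟨g, hg, Finset.mem_biUnion.2
        ⟨v, hvg, Finset.mem_filter.2 ⟨hE, hEv⟩⟩⟩
  have h1 : (A.biUnion fun e => F.filter fun E => c e ∈ E).card ≤ A.card * (3 * M.card) :=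
    Finset.card_biUnion_le_card_mul _ _ _ fun e _ => hdeg (c e)
  have h2 : ((M \ A).biUnion fun e => e.biUnion (pendants F M)).card ≤ (M \ A).card * 6 :=
    Finset.card_biUnion_le_card_mul _ _ _ fun e he => Finset.card_biUnion_le.trans
      (h.sum_pendants_le (Finset.mem_sdiff.1 he).1 (hB4 e he))
  have h3 := h.card_heavyEdges_le hA
  have h4 := Finset.card_le_card hcover
  have h5 := h4.trans ((Finset.card_union_le _ _).trans (Nat.add_le_add_right
    ((Finset.card_union_le _ _).trans (Nat.add_le_add_right (Finset.card_union_le _ _) _)) _))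
  have h6 : M.card = A.card + (M \ A).card := by
    rw [Finset.card_sdiff_of_subset hA.1]
    have := Finset.card_le_card hA.1
    omega
  rw [h6] at h1 ⊢
  -- With a stars and b non-stars, the four parts of the cover give 36a² + 92ab + 46b² + 46b.
  nlinarith

/-! ### Removing vertices of large degree -/

lemma exists_isMatching_card_eq (F : Finset (Finset V)) :
    ∃ M ⊆ F, IsMatching M ∧ M.card = matchingNumber F := by
  have hne : (F.powerset.filter fun M => IsMatching M).Nonempty :=
    ⟨∅, by simp [IsMatching]⟩
  obtain ⟨M, hM, hMc⟩ := Finset.exists_mem_eq_sup _ hne Finset.card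
  rw [Finset.mem_filter, Finset.mem_powerset] at hM
  exact ⟨M, hM.1, hM.2, hMc.symm⟩

lemma IsMatching.card_le_matchingNumber {F M : Finset (Finset V)} (hMF : M ⊆ F)
    (hM : IsMatching M) : M.card ≤ matchingNumber F :=
  Finset.le_sup (f := Finset.card) (Finset.mem_filter.2 ⟨Finset.mem_powerset.2 hMF, hM⟩)

lemma degree_le_maxDegree (F : Finset (Finset V)) (x : V) : degree F x ≤ maxDegree F := by
  by_cases hx : x ∈ vertices F
  · exact Finset.le_sup (f := degree F) hx
  · have : degree F x = 0 := by
      rw [degree, Finset.card_eq_zero, Finset.filter_eq_empty_iff]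
      exact fun A hA hxA => hx (mem_vertices.2 ⟨A, hA, hxA⟩)
    omega

/-- Deleting a vertex of degree more than `3 ν` lowers the matching number. -/
lemma matchingNumber_filter_lt {F : Finset (Finset V)} (hF : (F : Set (Finset V)).Sized 3)
    (hL : IsLinear F) {x : V} (hx : 3 * matchingNumber F < degree F x) :
    matchingNumber (F.filter fun A => x ∉ A) < matchingNumber F := by
  obtain ⟨M, hMG, hM, hMc⟩ := exists_isMatching_card_eq (F.filter fun A => x ∉ A)
  have hMF : M ⊆ F := hMG.trans (Finset.filter_subset _ _)
  rw [← hMc]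
  refine lt_of_le_of_ne (hM.card_le_matchingNumber hMF) fun hcard => ?_
  have hxM : x ∉ vertices M := fun hxM => by
    obtain ⟨e, he, hxe⟩ := mem_vertices.1 hxM
    exact (Finset.mem_filter.1 (hMG he)).2 hxe
  have hvert : (vertices M).card ≤ M.card * 3 :=
    Finset.card_biUnion_le_card_mul _ _ _ fun e he => (hF (Finset.mem_coe.2 (hMF he))).le
  -- The matching covers at most 3ν vertices, so some edge at `x` misses it and would extend it.
  obtain ⟨E, hE, hEd⟩ := hL.exists_disjoint (S := F.filter fun A => x ∈ A)
    (Finset.filter_subset _ _) (fun E hE => (Finset.mem_filter.1 hE).2) hxM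
    (by rw [degree] at hx; omega)
  rw [Finset.mem_filter] at hE
  have hEe : ∀ e ∈ M, Disjoint E e := fun e he => Finset.disjoint_left.2 fun z hz hze =>
    Finset.disjoint_left.1 hEd hz (mem_vertices.2 ⟨e, he, hze⟩)
  have hEM : E ∉ M := fun hEM => hxM (mem_vertices.2 ⟨E, hEM, hE.2⟩)
  have hins : IsMatching (insert E M) := by
    intro A hA B hB hAB
    rcases Finset.mem_insert.1 hA with hAE | hAM <;> rcases Finset.mem_insert.1 hB with hBE | hBM
    · exact absurd (hAE.trans hBE.symm) hAB
    · exact hAE ▸ hEe B hBM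
    · exact hBE ▸ (hEe A hAM).symm
    · exact hM A hAM B hBM hAB
  have := hins.card_le_matchingNumber (Finset.insert_subset hE.1 hMF)
  rw [Finset.card_insert_of_notMem hEM] at this
  omega

/-- Each deletion of a vertex costs at most `D` edges and lowers the matching number by at least
one. The cardinality bound is arranged to avoid subtraction; the last clause records that an
unchanged matching number means nothing was deleted. -/
lemma exists_subfamily_degree_le (n : ℕ) : ∀ (F : Finset (Finset V)) (D : ℕ),
    matchingNumber F = n → (F : Set (Finset V)).Sized 3 → IsLinear F → (∀ x, degree F x ≤ D) →
    ∃ G ⊆ F, matchingNumber G ≤ n ∧ (∀ x, degree G x ≤ 3 * matchingNumber G) ∧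
      F.card + D * matchingNumber G ≤ D * n + G.card ∧ (matchingNumber G = n → G = F) := by
  induction n using Nat.strong_induction_on with
  | _ n ih =>
    intro F D hn hF hL hD
    by_cases hdeg : ∀ x, degree F x ≤ 3 * matchingNumber F
    · exact ⟨F, subset_rfl, hn.le, hdeg, by rw [hn, add_comm], fun _ => rfl⟩
    push Not at hdeg
    obtain ⟨x, hx⟩ := hdeg
    have hlt := matchingNumber_filter_lt hF hL hx
    set F' := F.filter fun A => x ∉ A with hF'
    have hsub : F' ⊆ F := Finset.filter_subset _ _
    obtain ⟨G, hG1, hG2, hG3, hG4, -⟩ := ih (matchingNumber F') (hn ▸ hlt) F' D rfl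
      (fun A hA => hF (Finset.mem_coe.2 (hsub hA)))
      (fun A hA B hB => hL A (hsub hA) B (hsub hB))
      (fun y => (Finset.card_le_card (Finset.filter_subset_filter _ hsub)).trans (hD y))
    have hcard : degree F x + F'.card = F.card := Finset.card_filter_add_card_filter_not _
    have hDx := hD x
    refine ⟨G, hG1.trans hsub, by omega, hG3, ?_, fun h => by omega⟩
    have : D * (matchingNumber F' + 1) ≤ D * n := Nat.mul_le_mul_left _ (by omega)
    rw [mul_add] at this
    omega

lemma card_le_of_isLinear {F : Finset (Finset V)} {ν Δ : ℕ} (hF : (F : Set (Finset V)).Sized 3)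
    (hL : IsLinear F) (hν : matchingNumber F = ν) (hΔ : maxDegree F = Δ) (h1 : ν ≠ 1)
    (hΔν : (Δ : ℝ) ≥ 23 / 6 * (ν : ℝ) * (1 + 1 / ((ν : ℝ) - 1))) : F.card ≤ Δ * ν := by
  have hD : ∀ x, degree F x ≤ Δ := fun x => hΔ ▸ degree_le_maxDegree F x
  have hzero : ∀ G ⊆ F, matchingNumber G = 0 → G.card = 0 := by
    intro G hG h0
    by_contra hne
    obtain ⟨E, hE⟩ := Finset.card_pos.1 (Nat.pos_of_ne_zero hne)
    have := IsMatching.card_le_matchingNumber (F := G) (M := {E})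
      (Finset.singleton_subset_iff.2 hE) (by
        intro A hA B hB hAB
        rw [Finset.mem_singleton] at hA hB
        exact absurd (hA.trans hB.symm) hAB)
    rw [Finset.card_singleton] at this
    omega
  rcases Nat.eq_zero_or_pos ν with h0 | hpos
  · rw [hzero F subset_rfl (hν.trans h0)]
    exact Nat.zero_le _
  have h2 : 2 ≤ ν := by omega
  have h2R : (2 : ℝ) ≤ ν := by exact_mod_cast h2
  have hkey : (23 / 6 : ℝ) * (ν : ℝ) ^ 2 ≤ Δ * ((ν : ℝ) - 1) := by
    have hp : (0 : ℝ) < (ν : ℝ) - 1 := by linarith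
    have heq : 23 / 6 * (ν : ℝ) * (1 + 1 / ((ν : ℝ) - 1)) * ((ν : ℝ) - 1) =
        23 / 6 * (ν : ℝ) ^ 2 := by
      field_simp
      ring
    rw [← heq]
    exact mul_le_mul_of_nonneg_right hΔν hp.le
  obtain ⟨G, hGF, hGν, hGdeg, hGcard, hGeq⟩ := exists_subfamily_degree_le ν F Δ hν hF hL hD
  obtain ⟨M, hMG, hM, hMc⟩ := exists_isMatching_card_eq G
  have hmax : IsMaxMatching G M := ⟨fun A hA => hF (Finset.mem_coe.2 (hGF hA)),
    fun A hA B hB => hL A (hGF hA) B (hGF hB), hMG, hM,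
    fun N hN hN' => hMc ▸ hN'.card_le_matchingNumber hN⟩
  have hbound := hmax.card_le (by rw [hMc]; exact hGdeg)
  rw [hMc] at hbound
  set n := matchingNumber G with hn
  suffices hsuff : G.card ≤ Δ * n by omega
  rcases Nat.eq_zero_or_pos n with hn0 | hnpos
  · rw [hzero G hGF hn0]; exact Nat.zero_le _
  have hnν : n < ν := by
    -- Otherwise all degrees of `F` are at most 3ν, whereas the hypothesis forces Δ > (23/6)ν.
    refine lt_of_le_of_ne hGν fun hnν => ?_
    have hGF' := hGeq hnν
    have hΔ3 : Δ ≤ 3 * ν := by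
      rw [← hΔ, ← hnν]
      exact Finset.sup_le fun x _ => hGF' ▸ hGdeg x
    have hΔ3R : (Δ : ℝ) ≤ 3 * ν := by exact_mod_cast hΔ3
    nlinarith
  have hn1 : (1 : ℝ) ≤ n := by exact_mod_cast hnpos
  have hnp : (n : ℝ) ≤ (ν : ℝ) - 1 := by
    have : (n : ℝ) + 1 ≤ ν := by exact_mod_cast hnν
    linarith
  set p : ℝ := (ν : ℝ) - 1 with hp
  have hνp : (ν : ℝ) = p + 1 := by rw [hp]; ring
  rw [hνp] at hkey
  have hp0 : 0 < p := by linarith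
  -- The difference of the two sides is (p - n)(pn - 1), nonnegative as 1 ≤ n ≤ p.
  have hpn : (n + 1 : ℝ) ^ 2 * p ≤ (p + 1) ^ 2 * n := by
    have : 0 ≤ (p - n) * (p * n - 1) := mul_nonneg (by linarith) (by nlinarith)
    nlinarith
  have hfin : (23 / 6 : ℝ) * (n + 1) ^ 2 ≤ Δ * n := by
    refine le_of_mul_le_mul_right (a := p) ?_ hp0
    have : (23 / 6 : ℝ) * (p + 1) ^ 2 * n ≤ Δ * p * n :=
      mul_le_mul_of_nonneg_right hkey (by linarith)
    nlinarith
  have hboundR : (12 : ℝ) * G.card ≤ 46 * (n + 1) ^ 2 := by exact_mod_cast hbound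
  have : (G.card : ℝ) ≤ Δ * n := by linarith
  exact_mod_cast this

/-! ### Disjoint sunflowers attain the bound -/

lemma IsDisjointSunflowers.extremal {V : Type*} [DecidableEq V] {F : Finset (Finset V)}
    {n d : ℕ} (hn : 0 < n) (hd : 0 < d) (h : IsDisjointSunflowers F n d) :
    (F : Set (Finset V)).Sized 3 ∧ IsLinear F ∧ matchingNumber F = n ∧ maxDegree F = d ∧
      F.card = d * n := by
  obtain ⟨G, rfl, hG, hdis⟩ := h
  choose hsized hcard c hsub hinter using hG
  have hmem : ∀ {i A x}, A ∈ G i → x ∈ A → x ∈ vertices (G i) := fun hA hx =>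
    mem_vertices.2 ⟨_, hA, hx⟩
  have hcA : ∀ {i A}, A ∈ G i → c i ∈ A := fun hA => Finset.singleton_subset_iff.1 (hsub _ _ hA)
  have hidx : ∀ {i j A B x}, A ∈ G i → B ∈ G j → x ∈ A → x ∈ B → i = j := by
    intro i j A B x hA hB hxA hxB
    by_contra hij
    exact Finset.disjoint_left.1 (hdis i j hij) (hmem hA hxA) (hmem hB hxB)
  have hF : ∀ {A}, A ∈ Finset.univ.biUnion G ↔ ∃ i, A ∈ G i := by simp
  have hpick : ∀ i, ∃ A, A ∈ G i := fun i => Finset.card_pos.1 ((hcard i).symm ▸ hd)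
  choose P hP using hpick
  refine ⟨?_, ?_, le_antisymm ?_ ?_, le_antisymm ?_ ?_, ?_⟩
  · intro A hA
    obtain ⟨i, hi⟩ := hF.1 (Finset.mem_coe.1 hA)
    exact hsized i (Finset.mem_coe.2 hi)
  · intro A hA B hB hAB
    obtain ⟨i, hi⟩ := hF.1 hA
    obtain ⟨j, hj⟩ := hF.1 hB
    by_cases hij : i = j
    · subst hij
      rw [hinter i A hi B hj hAB, Finset.card_singleton]
    · rw [Finset.card_eq_zero.2]
      · exact Nat.zero_le _
      · rw [← Finset.disjoint_iff_inter_eq_empty, Finset.disjoint_left]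
        exact fun x hxA hxB => hij (hidx hi hj hxA hxB)
  · obtain ⟨M, hMF, hM, hMc⟩ := exists_isMatching_card_eq (Finset.univ.biUnion G)
    rw [← hMc]
    have hex : ∀ A ∈ M, ∃ i, A ∈ G i := fun A hA => hF.1 (hMF hA)
    have : Nonempty (Fin n) := ⟨⟨0, hn⟩⟩
    -- Petals of one sunflower share its core, so a matching uses at most one petal from each.
    choose! f hf using hex
    have hle := Finset.card_le_card_of_injOn (s := M) (t := Finset.univ) f (by simp) (by
      intro A hA B hB hAB
      by_contra hne
      exact Finset.disjoint_left.1 (hM A hA B hB hne) (hcA (hf A hA)) (hAB ▸ hcA (hf B hB)))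
    simpa using hle
  · have hinj : Function.Injective P := fun i j hij =>
      hidx (hP i) (hP j) (hcA (hP i)) (hij ▸ hcA (hP i))
    have hle := IsMatching.card_le_matchingNumber (F := Finset.univ.biUnion G)
      (M := Finset.univ.image P) (by
        intro A hA
        obtain ⟨i, -, rfl⟩ := Finset.mem_image.1 hA
        exact hF.2 ⟨i, hP i⟩) (by
        intro A hA B hB hAB
        obtain ⟨i, -, rfl⟩ := Finset.mem_image.1 hA
        obtain ⟨j, -, rfl⟩ := Finset.mem_image.1 hB
        refine Finset.disjoint_left.2 fun x hxA hxB => hAB ?_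
        rw [hidx (hP i) (hP j) hxA hxB])
    simpa [Finset.card_image_of_injective _ hinj] using hle
  · refine Finset.sup_le fun x hx => ?_
    obtain ⟨A, hA, hxA⟩ := mem_vertices.1 hx
    obtain ⟨i, hi⟩ := hF.1 hA
    rw [← hcard i]
    refine Finset.card_le_card fun B hB => ?_
    obtain ⟨hB, hxB⟩ := Finset.mem_filter.1 hB
    obtain ⟨j, hj⟩ := hF.1 hB
    exact hidx hj hi hxB hxA ▸ hj
  · rw [← hcard ⟨0, hn⟩]
    refine le_trans (Finset.card_le_card fun A hA => ?_)
      (degree_le_maxDegree (Finset.univ.biUnion G) (c ⟨0, hn⟩))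
    exact Finset.mem_filter.2 ⟨hF.2 ⟨_, hA⟩, hcA hA⟩
  · rw [Finset.card_biUnion]
    · simp [hcard, mul_comm]
    · intro i _ j _ hij
      exact Finset.disjoint_left.2 fun A hA hA' => hij (hidx hA hA' (hcA hA) (hcA hA))

lemma exists_isDisjointSunflowers (n d : ℕ) :
    ∃ F : Finset (Finset ℕ), IsDisjointSunflowers F n d := by
  -- The first coordinate under `Nat.pair` names the sunflower, which makes different sunflowers
  -- disjoint; second coordinate 0 is the core, and petal j owns 2j + 1 and 2j + 2.
  let petal : ℕ → ℕ → Finset ℕ := fun i j =>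
    {Nat.pair i 0, Nat.pair i (2 * j + 1), Nat.pair i (2 * j + 2)}
  have hinter : ∀ i j k, j ≠ k → petal i j ∩ petal i k = {Nat.pair i 0} := by
    intro i j k hjk
    ext x
    simp only [petal, Finset.mem_inter, Finset.mem_insert, Finset.mem_singleton]
    constructor
    · rintro ⟨rfl | rfl | rfl, h⟩ <;> simp only [Nat.pair_eq_pair] at h ⊢ <;> omega
    · rintro rfl
      simp
  have hcard3 : ∀ i j, (petal i j).card = 3 := fun i j =>
    Finset.card_eq_three.2 ⟨_, _, _, by simp, by simp, by simp, rfl⟩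
  have hinj : ∀ i, Function.Injective (petal i) := by
    intro i j k hjk
    by_contra hne
    have h1 := hinter i j k hne
    rw [← hjk, Finset.inter_self] at h1
    have h2 := hcard3 i j
    rw [h1] at h2
    simp at h2
  have hunpair : ∀ i j, ∀ x ∈ petal i j, x.unpair.1 = i := by
    intro i j x hx
    simp only [petal, Finset.mem_insert, Finset.mem_singleton] at hx
    rcases hx with rfl | rfl | rfl <;> simp
  refine ⟨_, fun i : Fin n => (Finset.range d).image (petal i), rfl, fun i => ⟨?_, ?_, ?_⟩, ?_⟩
  · intro A hA
    obtain ⟨j, -, rfl⟩ := Finset.mem_image.1 (Finset.mem_coe.1 hA)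
    exact hcard3 i j
  · rw [Finset.card_image_of_injective _ (hinj i), Finset.card_range]
  · refine ⟨Nat.pair i 0, fun A hA => ?_, fun A hA B hB hAB => ?_⟩
    · obtain ⟨j, -, rfl⟩ := Finset.mem_image.1 hA
      simp [petal]
    · obtain ⟨j, -, rfl⟩ := Finset.mem_image.1 hA
      obtain ⟨k, -, rfl⟩ := Finset.mem_image.1 hB
      exact hinter i j k fun hjk => hAB (by rw [hjk])
  · intro i j hij
    rw [Finset.disjoint_left]
    intro x hx hx'
    obtain ⟨A, hA, hxA⟩ := mem_vertices.1 hx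
    obtain ⟨B, hB, hxB⟩ := mem_vertices.1 hx'
    obtain ⟨a, -, rfl⟩ := Finset.mem_image.1 hA
    obtain ⟨b, -, rfl⟩ := Finset.mem_image.1 hB
    exact hij (Fin.ext ((hunpair i a x hxA).symm.trans (hunpair j b x hxB)))

end SetFamily

theorem theorem2 {V : Type*} [DecidableEq V] :
    (∀ (F : Finset (Finset V)) (ν Δ : ℕ),
      (F : Set (Finset V)).Sized 3 → SetFamily.IsLinear F →
      SetFamily.matchingNumber F = ν → SetFamily.maxDegree F = Δ → ν ≠ 1 →
      (Δ : ℝ) ≥ 23 / 6 * (ν : ℝ) * (1 + 1 / ((ν : ℝ) - 1)) →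
      F.card ≤ Δ * ν) ∧
    (∀ (F : Finset (Finset V)) (ν Δ : ℕ), 0 < ν → 0 < Δ →
      SetFamily.IsDisjointSunflowers F ν Δ →
      (F : Set (Finset V)).Sized 3 ∧ SetFamily.IsLinear F ∧
      SetFamily.matchingNumber F = ν ∧ SetFamily.maxDegree F = Δ ∧ F.card = Δ * ν) ∧
    (∀ ν Δ : ℕ, 0 < ν → 0 < Δ →
      ∃ F : Finset (Finset ℕ), SetFamily.IsDisjointSunflowers F ν Δ) :=
  ⟨fun _ _ _ hF hL hν hΔ h1 h => SetFamily.card_le_of_isLinear hF hL hν hΔ h1 h,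
    fun _ _ _ hν hΔ h => h.extremal hν hΔ,
    fun ν Δ _ _ => SetFamily.exists_isDisjointSunflowers ν Δ⟩
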